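/- Let $n\ge 1$ and let $\mathbf{D}=\{z\in\mathbf{C}:|z|<1\}$. Let $\mathcal{S}$ (the Schur class) be the set of all functions $A:\mathbf{D}\to M_n(\mathbf{C})$ such that all entries of $A$ are holomorphic on $\mathbf{D}$, the matrix $I-A(z)A(z)^*$ is positive semidefinite for every $z\in\mathbf{D}$ (equivalently, $\|A(z)\|\le 1$ in the operator norm induced by the Euclidean norm), and $\det A$ does not vanish identically on $\mathbf{D}$. Let $A_1,A_2\in\mathcal{S}$. Then there exist $\tilde A_1,\tilde A_2\in\mathcal{S}$ such that $$A_1(z)A_2(z)=\tilde A_2(z)\tilde A_1(z)\quad\text{and}\quad \det\tilde A_j(z)=\det A_j(z)\quad (j=1,2)$$ for all $z\in\mathbf{D}$. -/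

import Mathlib

open scoped ComplexOrder

/-- The Schur class of `n × n` matrix-valued functions on the open unit disk `Metric.ball 0 1`:
analytic (entrywise holomorphic), contractive, with determinant not identically zero.
Functions are taken on all of `ℂ`, but only their values on the disk are constrained. -/
structure IsSchurClass {n : ℕ} (A : ℂ → Matrix (Fin n) (Fin n) ℂ) : Prop where
  analytic : ∀ i j, DifferentiableOn ℂ (fun z => A z i j) (Metric.ball (0 : ℂ) 1)
  contractive : ∀ z ∈ Metric.ball (0 : ℂ) 1, (1 - A z * (A z).conjTranspose).PosSemidef
  det_ne_zero : ∃ z ∈ Metric.ball (0 : ℂ) 1, (A z).det ≠ 0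

/-! ### Contractions and completion of isometries -/

open Matrix Polynomial Filter Topology

/-! The swap is linear algebra for transfer functions `D + z C (1 - z M)⁻¹ B` of finite-dimensional
unitary colligations, and the general case follows by compactness.

For such a function Θ, let `p` be the characteristic polynomial of `M`. Then det Θ is, up to a
unimodular constant, the finite Blaschke product determined by `p` (`IsRealized.exists_det_eq`).
Cascading two colligations multiplies the functions and makes the main operator block triangular, so
the polynomials multiply. Conversely, an invariant subspace of `M` splits off a left factor
(`exists_cascade_of_block_triangular`). Since `M` can be triangularised with its eigenvalues in any
order, a product with polynomial `p * q = q * p` can be cut with either polynomial on the left. This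
is `IsRealized.exists_swap`.

A general Schur function is a pointwise limit of realized ones. Its truncated block Toeplitz
matrices are contractions, and a lurking isometry argument turns each of them into a colligation
whose transfer function has the same Taylor polynomial (`exists_isRealized_near`). Swapping the
approximants and passing to the limit along an ultrafilter swaps the factors, with determinants
correct up to constants `c` and `d`. Nonvanishing of the determinants forces `c * d = 1`, and an
n-th root of `c` is then moved from one factor to the other. -/

theorem Matrix.posSemidef_one_sub_conjTranspose_mul_self_iff {m n : Type*} [Fintype m] [Fintype n]
    [DecidableEq m] [DecidableEq n] (A : Matrix m n ℂ) :
    (1 - Aᴴ * A).PosSemidef ↔ (1 - A * Aᴴ).PosSemidef := by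
  let _ : Invertible (1 : Matrix m m ℂ) := invertibleOne
  let _ : Invertible (1 : Matrix n n ℂ) := invertibleOne
  -- Both conditions are Schur complements of the one block matrix with rows (1, A) and (Aᴴ, 1).
  have h₁ := PosDef.fromBlocks₁₁ (A := (1 : Matrix m m ℂ)) A 1 PosDef.one
  have h₂ := PosDef.fromBlocks₂₂ (1 : Matrix m m ℂ) A (D := (1 : Matrix n n ℂ)) PosDef.one
  simp only [inv_one, Matrix.mul_one] at h₁ h₂
  exact h₁.symm.trans h₂

/-- A matrix with orthonormal columns extends to a unitary matrix. -/
theorem Matrix.exists_fromCols_unitary {ι α β : Type*} [Fintype ι] [Fintype α] [Fintype β]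
    [DecidableEq ι] [DecidableEq α] [DecidableEq β]
    (hcard : Fintype.card ι = Fintype.card (α ⊕ β)) (V : Matrix ι α ℂ) (hV : Vᴴ * V = 1) :
    ∃ W : Matrix ι β ℂ, (fromCols V W)ᴴ * fromCols V W = 1 ∧
      fromCols V W * (fromCols V W)ᴴ = 1 := by
  let v : α ⊕ β → EuclideanSpace ℂ ι :=
    Sum.elim (fun a => WithLp.toLp 2 (fun i => V i a)) (fun _ => 0)
  have hv : Orthonormal ℂ ((Set.range (Sum.inl : α → α ⊕ β)).domRestrict v) := by
    rw [orthonormal_iff_ite]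
    rintro ⟨_, a, rfl⟩ ⟨_, b, rfl⟩
    have := congrFun (congrFun hV a) b
    simp only [mul_apply, conjTranspose_apply, one_apply] at this
    simp only [Set.domRestrict_apply, v, Sum.elim_inl, PiLp.inner_apply, RCLike.inner_apply']
    by_cases hab : a = b
    · subst hab
      simpa using this
    · rw [if_neg hab] at this
      rw [if_neg fun h => hab (Sum.inl_injective (congrArg Subtype.val h))]
      simpa using this
  obtain ⟨b, hb⟩ := hv.exists_orthonormalBasis_extension_of_card_eq (by simpa using hcard)
  have hVW : fromCols V (of fun i j => b (Sum.inr j) i) = of fun i j => b j i := by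
    ext i (a | j)
    · simp [hb (Sum.inl a) ⟨a, rfl⟩, v]
    · simp
  have h1 : (of fun i j => b j i : Matrix ι (α ⊕ β) ℂ)ᴴ * (of fun i j => b j i) = 1 := by
    ext i j
    have := orthonormal_iff_ite.1 b.orthonormal i j
    simpa [mul_apply, one_apply, PiLp.inner_apply, mul_comm] using this
  refine ⟨of fun i j => b (Sum.inr j) i, by rw [hVW, h1], ?_⟩
  rw [hVW]
  exact (mul_eq_one_comm_of_card_eq _ _ _ hcard.symm).1 h1

/-! ### Transfer functions of unitary colligations -/

section Realization

variable {ι κ n : Type*} [Fintype ι] [Fintype κ] [Fintype n] [DecidableEq ι] [DecidableEq κ]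
  [DecidableEq n]

set_option linter.unusedSectionVars false

/-- Block form of the condition that `fromBlocks M B C D` is an isometry. -/
theorem Matrix.fromBlocks_conjTranspose_mul_self_eq_one_iff
    {M : Matrix ι ι ℂ} {B : Matrix ι n ℂ} {C : Matrix n ι ℂ} {D : Matrix n n ℂ} :
    (fromBlocks M B C D)ᴴ * fromBlocks M B C D = 1 ↔
      Mᴴ * M + Cᴴ * C = 1 ∧ Mᴴ * B + Cᴴ * D = 0 ∧ Bᴴ * B + Dᴴ * D = 1 := by
  rw [fromBlocks_conjTranspose, fromBlocks_multiply, ← fromBlocks_one, fromBlocks_inj]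
  refine ⟨fun h => ⟨h.1, h.2.1, h.2.2.2⟩, fun h => ⟨h.1, h.2.1, ?_, h.2.2⟩⟩
  simpa using congrArg conjTranspose h.2.1

/-- The value at `z` of the transfer function `D + z C (1 - z M)⁻¹ B` is `Θ`; the witness `X` is
`(1 - z M)⁻¹ B`. -/
def IsTransferValue (M : Matrix ι ι ℂ) (B : Matrix ι n ℂ) (C : Matrix n ι ℂ) (D : Matrix n n ℂ)
    (z : ℂ) (Θ : Matrix n n ℂ) : Prop :=
  ∃ X : Matrix ι n ℂ, X = z • (M * X) + B ∧ Θ = z • (C * X) + D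

/-- The isometry sends the column `(z X, 1)` to `(X, Θ)`, so the two columns have the same Gram
matrix. -/
theorem one_sub_transfer_eq {M : Matrix ι ι ℂ} {B : Matrix ι n ℂ} {C : Matrix n ι ℂ}
    {D : Matrix n n ℂ} (hU : (fromBlocks M B C D)ᴴ * fromBlocks M B C D = 1) {z : ℂ}
    {Θ : Matrix n n ℂ} {X : Matrix ι n ℂ} (hX : X = z • (M * X) + B) (hΘ : Θ = z • (C * X) + D) :
    1 - Θᴴ * Θ = (1 - ‖z‖ ^ 2 : ℝ) • (Xᴴ * X) := by
  have h1 : fromRows X Θ = fromBlocks M B C D * fromRows (z • X) (1 : Matrix n n ℂ) := by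
    rw [fromBlocks_mul_fromRows]
    simp only [Matrix.mul_smul, Matrix.mul_one]
    rw [← hX, ← hΘ]
  have h2 : (fromRows X Θ)ᴴ * fromRows X Θ = (fromRows (z • X) (1 : Matrix n n ℂ))ᴴ * fromRows (z • X) (1 : Matrix n n ℂ) := by
    rw [h1, conjTranspose_mul, Matrix.mul_assoc, ← Matrix.mul_assoc _ (fromBlocks M B C D), hU,
      Matrix.one_mul]
  simp only [conjTranspose_fromRows_eq_fromCols_conjTranspose, fromCols_mul_fromRows,
    conjTranspose_smul, Matrix.smul_mul, Matrix.mul_smul, smul_smul, conjTranspose_one,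
    Matrix.mul_one] at h2
  have h3 : z * star z = ((‖z‖ ^ 2 : ℝ) : ℂ) := by
    simpa using Complex.mul_conj' z
  rw [h3] at h2
  have h4 : ((‖z‖ ^ 2 : ℝ) : ℂ) • (Xᴴ * X) = (‖z‖ ^ 2 : ℝ) • (Xᴴ * X) := by
    ext; simp
  rw [h4] at h2
  rw [sub_smul, one_smul, sub_eq_sub_iff_add_eq_add, h2, add_comm]

/-- `M` is a contraction, being a block of an isometric column, so `v = z M v` with `‖z‖ < 1` forces
`v = 0`. -/
theorem det_one_sub_smul_ne_zero {M : Matrix ι ι ℂ} {C : Matrix n ι ℂ}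
    (hM : Mᴴ * M + Cᴴ * C = 1) {z : ℂ} (hz : ‖z‖ < 1) : (1 - z • M).det ≠ 0 := by
  intro h
  obtain ⟨v, hv0, hv⟩ := exists_mulVec_eq_zero_iff.2 h
  rw [sub_mulVec, one_mulVec, sub_eq_zero, smul_mulVec] at hv
  have h1 : star v ⬝ᵥ v = star (M *ᵥ v) ⬝ᵥ (M *ᵥ v) + star (C *ᵥ v) ⬝ᵥ (C *ᵥ v) := by
    calc star v ⬝ᵥ v = star v ⬝ᵥ ((Mᴴ * M + Cᴴ * C) *ᵥ v) := by rw [hM, one_mulVec]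
      _ = _ := by
        simp only [star_mulVec, add_mulVec, dotProduct_add, dotProduct_mulVec, vecMul_vecMul]
  have h2 : star v ⬝ᵥ v = (‖z‖ ^ 2 : ℝ) * (star (M *ᵥ v) ⬝ᵥ (M *ᵥ v)) := by
    calc star v ⬝ᵥ v = star (z • M *ᵥ v) ⬝ᵥ (z • M *ᵥ v) := by rw [← hv]
      _ = _ := by
        rw [star_smul, smul_dotProduct, dotProduct_smul, smul_smul, smul_eq_mul]
        congr 1
        simpa using Complex.conj_mul' z
  have h3 : (0 : ℂ) < star v ⬝ᵥ v := dotProduct_star_self_pos_iff.2 hv0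
  have h4 : (0 : ℂ) ≤ star (M *ᵥ v) ⬝ᵥ (M *ᵥ v) := dotProduct_star_self_nonneg _
  have h5 : (0 : ℂ) ≤ star (C *ᵥ v) ⬝ᵥ (C *ᵥ v) := dotProduct_star_self_nonneg _
  have h1' := congrArg Complex.re h1
  have h2' := congrArg Complex.re h2
  rw [Complex.add_re] at h1'
  rw [Complex.re_ofReal_mul] at h2'
  have h3' := (Complex.lt_def.1 h3).1
  have h4' := (Complex.le_def.1 h4).1
  have h5' := (Complex.le_def.1 h5).1
  simp only [Complex.zero_re] at h3' h4' h5'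
  have hb : 0 < (star (M *ᵥ v) ⬝ᵥ M *ᵥ v).re := by
    rcases h4'.eq_or_lt with h | h
    · rw [← h, mul_zero] at h2'
      exact absurd h2' h3'.ne'
    · exact h
  have ht : ‖z‖ ^ 2 < 1 := by nlinarith [norm_nonneg z]
  nlinarith [mul_pos hb (sub_pos.2 ht)]

theorem IsTransferValue.posSemidef {M : Matrix ι ι ℂ} {B : Matrix ι n ℂ} {C : Matrix n ι ℂ}
    {D : Matrix n n ℂ} (hU : (fromBlocks M B C D)ᴴ * fromBlocks M B C D = 1) {z : ℂ} (hz : ‖z‖ < 1)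
    {Θ : Matrix n n ℂ} (h : IsTransferValue M B C D z Θ) : (1 - Θ * Θᴴ).PosSemidef := by
  obtain ⟨X, hX, hΘ⟩ := h
  rw [← posSemidef_one_sub_conjTranspose_mul_self_iff, one_sub_transfer_eq hU hX hΘ]
  exact (posSemidef_conjTranspose_mul_self X).smul (by nlinarith [norm_nonneg z])

theorem isTransferValue_iff {M : Matrix ι ι ℂ} {B : Matrix ι n ℂ} {C : Matrix n ι ℂ}
    {D : Matrix n n ℂ} {z : ℂ} (hz : (1 - z • M).det ≠ 0) {Θ : Matrix n n ℂ} :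
    IsTransferValue M B C D z Θ ↔ Θ = z • (C * ((1 - z • M)⁻¹ * B)) + D := by
  have hu : IsUnit (1 - z • M).det := hz.isUnit
  have key : ∀ X : Matrix ι n ℂ, X = z • (M * X) + B ↔ X = (1 - z • M)⁻¹ * B := by
    intro X
    have : X = z • (M * X) + B ↔ (1 - z • M) * X = B := by
      rw [Matrix.sub_mul, Matrix.one_mul, Matrix.smul_mul, sub_eq_iff_eq_add, add_comm]
    rw [this]
    constructor
    · rintro rfl
      rw [nonsing_inv_mul_cancel_left _ _ hu]
    · rintro rfl
      rw [mul_nonsing_inv_cancel_left _ _ hu]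
  simp [IsTransferValue, key]

theorem DifferentiableOn.matrix_det {s : Set ℂ} {F : ℂ → Matrix ι ι ℂ}
    (hF : ∀ i j, DifferentiableOn ℂ (fun z => F z i j) s) :
    DifferentiableOn ℂ (fun z => (F z).det) s := by
  simp only [det_apply]
  refine DifferentiableOn.fun_sum fun σ _ => ?_
  exact (DifferentiableOn.fun_finsetProd fun i _ => hF _ _).const_smul _

theorem IsTransferValue.differentiableOn {M : Matrix ι ι ℂ} {B : Matrix ι n ℂ} {C : Matrix n ι ℂ}
    {D : Matrix n n ℂ} {s : Set ℂ} (hs : ∀ z ∈ s, (1 - z • M).det ≠ 0) {Θ : ℂ → Matrix n n ℂ}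
    (h : ∀ z ∈ s, IsTransferValue M B C D z (Θ z)) (a b : n) :
    DifferentiableOn ℂ (fun z => Θ z a b) s := by
  have hent : ∀ i j, DifferentiableOn ℂ (fun z : ℂ => (1 - z • M) i j) s := by
    intro i j
    simp only [Matrix.sub_apply, Matrix.smul_apply, smul_eq_mul]
    fun_prop
  have hadj : ∀ i j, DifferentiableOn ℂ (fun z : ℂ => (1 - z • M).adjugate i j) s := by
    intro i j
    simp only [adjugate_apply]
    refine DifferentiableOn.matrix_det fun k l => ?_
    by_cases hk : k = j
    · subst hk
      simp only [updateRow_self]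
      fun_prop
    · simp only [updateRow_ne hk]
      exact hent k l
  have hinv : ∀ i j, DifferentiableOn ℂ (fun z : ℂ => ((1 - z • M)⁻¹) i j) s := by
    intro i j
    simp only [inv_def, Matrix.smul_apply, smul_eq_mul, Ring.inverse_eq_inv']
    exact ((DifferentiableOn.matrix_det hent).inv hs).mul (hadj i j)
  have hΘ : DifferentiableOn ℂ
      (fun z : ℂ => (z • (C * ((1 - z • M)⁻¹ * B)) + D) a b) s := by
    simp only [Matrix.add_apply, Matrix.smul_apply, mul_apply, smul_eq_mul]
    refine DifferentiableOn.add_const _ (differentiableOn_id.mul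
      (DifferentiableOn.fun_sum fun i _ => (DifferentiableOn.fun_sum fun j _ => ?_).const_mul _))
    exact (hinv i j).mul_const _
  refine hΘ.congr fun z hz => ?_
  rw [← (isTransferValue_iff (hs z hz)).1 (h z hz)]

theorem Matrix.eval_charpolyRev' (M : Matrix ι ι ℂ) (z : ℂ) :
    M.charpolyRev.eval z = (1 - z • M).det := by
  rw [charpolyRev, ← coe_evalRingHom, RingHom.map_det]
  congr 1
  ext i j
  simp [one_apply, apply_ite (eval z)]
  exact mul_comm _ _

/-- One block determinant is computed twice. A Schur complement gives `det (1 - z M) * det Θ`. After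
a sign change in the first block column, the same matrix is a block triangular matrix times the
unitary colligation, which brings in `det (z - Mᴴ)`. -/
theorem IsTransferValue.det_mul_reverse_charpoly {M : Matrix ι ι ℂ} {B : Matrix ι n ℂ} {C : Matrix n ι ℂ}
    {D : Matrix n n ℂ} (hU : (fromBlocks M B C D)ᴴ * fromBlocks M B C D = 1) {z : ℂ} (hz : ‖z‖ < 1)
    {Θ : Matrix n n ℂ} (h : IsTransferValue M B C D z Θ) :
    Θ.det * M.charpoly.reverse.eval z =
      (-1) ^ Fintype.card ι * (fromBlocks M B C D).det * star (M.charpoly.eval (star z)) := by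
  have hM := (fromBlocks_conjTranspose_mul_self_eq_one_iff.1 hU).1
  have hdet := det_one_sub_smul_ne_zero hM hz
  have hΘ := (isTransferValue_iff hdet).1 h
  have h1 : (fromBlocks (1 - z • M) (z • B) (-C) D).det = (1 - z • M).det * Θ.det := by
    let _ := invertibleOfIsUnitDet (1 - z • M) hdet.isUnit
    rw [det_fromBlocks₁₁, hΘ, invOf_eq_nonsing_inv]
    congr 2
    simp only [Matrix.neg_mul, Matrix.mul_smul, Matrix.mul_assoc, smul_neg, sub_neg_eq_add]
    exact add_comm _ _
  have h2 : fromBlocks (1 - z • M) (z • B) (-C) D * fromBlocks (-1) 0 0 1 =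
      fromBlocks (z • 1 - Mᴴ) (-Cᴴ) 0 1 * fromBlocks M B C D := by
    -- Written this way, the product with the colligation `U` only involves `Uᴴ * U = 1`.
    have e : fromBlocks (z • 1 - Mᴴ) (-Cᴴ) 0 1 = fromBlocks (z • 1) 0 0 1 -
        fromBlocks (1 : Matrix ι ι ℂ) 0 0 (0 : Matrix n n ℂ) * (fromBlocks M B C D)ᴴ := by
      simp [fromBlocks_conjTranspose, fromBlocks_multiply, sub_eq_add_neg, fromBlocks_neg, fromBlocks_add]
    rw [e, Matrix.sub_mul, Matrix.mul_assoc, hU]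
    simp [fromBlocks_multiply, sub_eq_add_neg, fromBlocks_neg, fromBlocks_add]
  have h3 := congrArg det h2
  rw [det_mul, det_mul, h1, det_fromBlocks_zero₂₁, det_fromBlocks_zero₂₁] at h3
  simp only [det_one, mul_one, det_neg] at h3
  have h4 : (z • 1 - Mᴴ).det = star (M.charpoly.eval (star z)) := by
    rw [eval_charpoly, ← det_conjTranspose]
    congr 1
    ext i j
    simp [diagonal_apply, one_apply, apply_ite star, eq_comm]
  rw [reverse_charpoly, eval_charpolyRev', mul_comm Θ.det, ← h4]
  have h5 : ((-1 : ℂ) ^ Fintype.card ι) * (-1) ^ Fintype.card ι = 1 := by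
    rw [← mul_pow]; simp
  linear_combination (-1) ^ Fintype.card ι * h3 - (1 - z • M).det * Θ.det * h5

end Realization

/-! ### Cascades and invariant subspaces -/

section Cascade

variable {α κ n : Type} [Fintype α] [Fintype κ] [Fintype n] [DecidableEq α] [DecidableEq κ]
  [DecidableEq n]
  {M₁ : Matrix α α ℂ} {B₁ : Matrix α n ℂ} {C₁ : Matrix n α ℂ} {D₁ : Matrix n n ℂ}
  {M₂ : Matrix κ κ ℂ} {B₂ : Matrix κ n ℂ} {C₂ : Matrix n κ ℂ} {D₂ : Matrix n n ℂ}

set_option linter.unusedSectionVars false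

theorem isTransferValue_cascade {z : ℂ} {Θ₁ Θ₂ : Matrix n n ℂ}
    (h₁ : IsTransferValue M₁ B₁ C₁ D₁ z Θ₁) (h₂ : IsTransferValue M₂ B₂ C₂ D₂ z Θ₂) :
    IsTransferValue (fromBlocks M₁ (B₁ * C₂) 0 M₂) (fromRows (B₁ * D₂) B₂)
      (fromCols C₁ (D₁ * C₂)) (D₁ * D₂) z (Θ₁ * Θ₂) := by
  obtain ⟨X₁, hX₁, rfl⟩ := h₁
  obtain ⟨X₂, hX₂, hΘ₂⟩ := h₂
  -- The output Θ₂ of the second system is the input of the first, whose state is therefore `X₁ *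
  -- Θ₂`.
  refine ⟨fromRows (X₁ * Θ₂) X₂, ?_, ?_⟩
  · rw [fromBlocks_mul_fromRows, Matrix.zero_mul, zero_add]
    have h1 : X₁ * Θ₂ = z • (M₁ * (X₁ * Θ₂) + B₁ * C₂ * X₂) + B₁ * D₂ := by
      calc X₁ * Θ₂ = (z • (M₁ * X₁) + B₁) * Θ₂ := by rw [← hX₁]
        _ = z • (M₁ * (X₁ * Θ₂)) + B₁ * (z • (C₂ * X₂) + D₂) := by
          rw [Matrix.add_mul, ← hΘ₂, Matrix.smul_mul, Matrix.mul_assoc]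
        _ = _ := by
          rw [Matrix.mul_add, Matrix.mul_smul, smul_add, Matrix.mul_assoc, add_assoc]
    ext (i | i) j
    · simpa [mul_add] using congrFun (congrFun h1 i) j
    · simpa using congrFun (congrFun hX₂ i) j
  · rw [fromCols_mul_fromRows, hΘ₂]
    simp only [Matrix.add_mul, Matrix.mul_add, Matrix.smul_mul, Matrix.mul_smul, smul_add,
      Matrix.mul_assoc]
    abel

theorem triangular_conjTranspose_mul_self_eq_one_iff {X : Matrix α κ ℂ} {Y : Matrix α n ℂ}
    {Z : Matrix n κ ℂ} {W : Matrix n n ℂ} :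
    (fromBlocks (fromBlocks M₁ X 0 M₂) (fromRows Y B₂) (fromCols C₁ Z) W)ᴴ *
      fromBlocks (fromBlocks M₁ X 0 M₂) (fromRows Y B₂) (fromCols C₁ Z) W = 1 ↔
    M₁ᴴ * M₁ + C₁ᴴ * C₁ = 1 ∧ M₁ᴴ * X + C₁ᴴ * Z = 0 ∧ Xᴴ * X + M₂ᴴ * M₂ + Zᴴ * Z = 1 ∧
      M₁ᴴ * Y + C₁ᴴ * W = 0 ∧ Xᴴ * Y + M₂ᴴ * B₂ + Zᴴ * W = 0 ∧
      Yᴴ * Y + B₂ᴴ * B₂ + Wᴴ * W = 1 := by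
  have hzero : ∀ (P : Matrix α n ℂ) (Q : Matrix κ n ℂ), fromRows P Q = 0 ↔ P = 0 ∧ Q = 0 := by
    intro P Q
    rw [← fromRows_zero, fromRows_ext_iff]
  have hadd : ∀ (P P' : Matrix α n ℂ) (Q Q' : Matrix κ n ℂ),
      fromRows P Q + fromRows P' Q' = fromRows (P + P') (Q + Q') := by
    intro P P' Q Q'
    ext (i | i) j <;> simp
  rw [fromBlocks_conjTranspose_mul_self_eq_one_iff]
  rw [fromBlocks_conjTranspose, conjTranspose_fromRows_eq_fromCols_conjTranspose,
    conjTranspose_fromCols_eq_fromRows_conjTranspose, fromBlocks_multiply,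
    fromBlocks_mul_fromRows, fromRows_mul_fromCols, fromCols_mul_fromRows, fromRows_mul,
    fromBlocks_add, ← fromBlocks_one, fromBlocks_inj, hadd, hzero]
  simp only [conjTranspose_zero, Matrix.zero_mul, Matrix.mul_zero, add_zero]
  constructor
  · rintro ⟨⟨h1, h2, -, h3⟩, ⟨h4, h5⟩, h6⟩
    exact ⟨h1, h2, h3, h4, h5, h6⟩
  · rintro ⟨h1, h2, h3, h4, h5, h6⟩
    exact ⟨⟨h1, h2, by simpa using congrArg conjTranspose h2, h3⟩, ⟨h4, h5⟩, h6⟩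

/-- The column `(B₁, D₁)` is isometric and orthogonal to `(M₁, C₁)`. The Gram relations of the
remaining columns thus reduce to those of the second colligation. -/
theorem cascade_conjTranspose_mul_self
    (h₁ : (fromBlocks M₁ B₁ C₁ D₁)ᴴ * fromBlocks M₁ B₁ C₁ D₁ = 1)
    (h₂ : (fromBlocks M₂ B₂ C₂ D₂)ᴴ * fromBlocks M₂ B₂ C₂ D₂ = 1) :
    (fromBlocks (fromBlocks M₁ (B₁ * C₂) 0 M₂) (fromRows (B₁ * D₂) B₂)
      (fromCols C₁ (D₁ * C₂)) (D₁ * D₂))ᴴ * fromBlocks (fromBlocks M₁ (B₁ * C₂) 0 M₂)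
        (fromRows (B₁ * D₂) B₂) (fromCols C₁ (D₁ * C₂)) (D₁ * D₂) = 1 := by
  obtain ⟨a₁, b₁, c₁⟩ := fromBlocks_conjTranspose_mul_self_eq_one_iff.1 h₁
  obtain ⟨a₂, b₂, c₂⟩ := fromBlocks_conjTranspose_mul_self_eq_one_iff.1 h₂
  have orth : ∀ {β : Type} (P : Matrix n β ℂ), M₁ᴴ * (B₁ * P) + C₁ᴴ * (D₁ * P) = 0 := by
    intro β P
    rw [← Matrix.mul_assoc, ← Matrix.mul_assoc, ← Matrix.add_mul, b₁, Matrix.zero_mul]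
  have gram : ∀ {β γ : Type} (P : Matrix n β ℂ) (Q : Matrix n γ ℂ),
      (B₁ * P)ᴴ * (B₁ * Q) + (D₁ * P)ᴴ * (D₁ * Q) = Pᴴ * Q := by
    intro β γ P Q
    calc _ = Pᴴ * ((B₁ᴴ * B₁ + D₁ᴴ * D₁) * Q) := by
          simp only [conjTranspose_mul, Matrix.mul_assoc, Matrix.add_mul, Matrix.mul_add]
      _ = _ := by rw [c₁, Matrix.one_mul]
  rw [triangular_conjTranspose_mul_self_eq_one_iff]
  refine ⟨a₁, orth _, ?_, orth _, ?_, ?_⟩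
  · rw [add_right_comm, gram, add_comm, a₂]
  · rw [add_right_comm, gram, add_comm, b₂]
  · rw [add_right_comm, gram, add_comm, c₂]

/-- A unitary colligation whose main operator leaves a coordinate subspace invariant is a
cascade. -/
theorem exists_cascade_of_block_triangular {X : Matrix α κ ℂ} {Y : Matrix α n ℂ} {Z : Matrix n κ ℂ}
    {W : Matrix n n ℂ}
    (h : (fromBlocks (fromBlocks M₁ X 0 M₂) (fromRows Y B₂) (fromCols C₁ Z) W)ᴴ *
      fromBlocks (fromBlocks M₁ X 0 M₂) (fromRows Y B₂) (fromCols C₁ Z) W = 1) :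
    ∃ (B₁ : Matrix α n ℂ) (D₁ : Matrix n n ℂ) (C₂ : Matrix n κ ℂ) (D₂ : Matrix n n ℂ),
      (fromBlocks M₁ B₁ C₁ D₁)ᴴ * fromBlocks M₁ B₁ C₁ D₁ = 1 ∧
      (fromBlocks M₂ B₂ C₂ D₂)ᴴ * fromBlocks M₂ B₂ C₂ D₂ = 1 ∧
      X = B₁ * C₂ ∧ Y = B₁ * D₂ ∧ Z = D₁ * C₂ ∧ W = D₁ * D₂ := by
  obtain ⟨q1, q2, q3, q4, q5, h3⟩ := triangular_conjTranspose_mul_self_eq_one_iff.1 h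
  -- The invariant block already gives an isometric column `(M₁, C₁)`; its unitary completion
  -- supplies `B₁` and `D₁`.
  obtain ⟨V, -, hV⟩ := exists_fromCols_unitary (β := n) (ι := α ⊕ n) (by simp) (fromRows M₁ C₁) (by
    rw [conjTranspose_fromRows_eq_fromCols_conjTranspose, fromCols_mul_fromRows, q1])
  obtain ⟨B₁, D₁, rfl⟩ : ∃ B₁ D₁, V = fromRows B₁ D₁ := ⟨_, _, (fromRows_toRows V).symm⟩
  rw [fromCols_fromRows_eq_fromBlocks] at hV
  have hV' := mul_eq_one_comm.1 hV
  rw [fromBlocks_conjTranspose, fromBlocks_multiply, ← fromBlocks_one, fromBlocks_inj] at hV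
  obtain ⟨r1, r2, r3, r4⟩ := hV
  -- A column orthogonal to `(M₁, C₁)` lies in the range of `(B₁, D₁)`, and the adjoint reads off
  -- its coordinates. These coordinates become `C₂` and `D₂`.
  have key : ∀ {β : Type} (P : Matrix α β ℂ) (Q : Matrix n β ℂ), M₁ᴴ * P + C₁ᴴ * Q = 0 →
      P = B₁ * (B₁ᴴ * P + D₁ᴴ * Q) ∧ Q = D₁ * (B₁ᴴ * P + D₁ᴴ * Q) := by
    intro β P Q hPQ
    have s1 : M₁ * (M₁ᴴ * P + C₁ᴴ * Q) = 0 := by rw [hPQ, Matrix.mul_zero]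
    have s2 : C₁ * (M₁ᴴ * P + C₁ᴴ * Q) = 0 := by rw [hPQ, Matrix.mul_zero]
    rw [Matrix.mul_add, ← Matrix.mul_assoc, ← Matrix.mul_assoc] at s1 s2 ⊢
    rw [Matrix.mul_add, ← Matrix.mul_assoc, ← Matrix.mul_assoc]
    constructor
    · calc P = (M₁ * M₁ᴴ + B₁ * B₁ᴴ) * P + (M₁ * C₁ᴴ + B₁ * D₁ᴴ) * Q := by
            rw [r1, r2, Matrix.one_mul, Matrix.zero_mul, add_zero]
        _ = (M₁ * M₁ᴴ * P + M₁ * C₁ᴴ * Q) + (B₁ * B₁ᴴ * P + B₁ * D₁ᴴ * Q) := by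
            simp only [Matrix.add_mul]; abel
        _ = _ := by rw [s1, zero_add]
    · calc Q = (C₁ * M₁ᴴ + D₁ * B₁ᴴ) * P + (C₁ * C₁ᴴ + D₁ * D₁ᴴ) * Q := by
            rw [r3, r4, Matrix.one_mul, Matrix.zero_mul, zero_add]
        _ = (C₁ * M₁ᴴ * P + C₁ * C₁ᴴ * Q) + (D₁ * B₁ᴴ * P + D₁ * D₁ᴴ * Q) := by
            simp only [Matrix.add_mul]; abel
        _ = _ := by rw [s2, zero_add]
  obtain ⟨kX, kZ⟩ := key X Z q2
  obtain ⟨kY, kW⟩ := key Y W q4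
  have gram : ∀ {β γ : Type} (P : Matrix α β ℂ) (Q : Matrix n β ℂ) (P' : Matrix α γ ℂ)
      (Q' : Matrix n γ ℂ), M₁ᴴ * P' + C₁ᴴ * Q' = 0 →
      (B₁ᴴ * P + D₁ᴴ * Q)ᴴ * (B₁ᴴ * P' + D₁ᴴ * Q') = Pᴴ * P' + Qᴴ * Q' := by
    intro β γ P Q P' Q' hPQ
    obtain ⟨k1, k2⟩ := key P' Q' hPQ
    refine Eq.trans ?_ (congrArg₂ (fun R S => Pᴴ * R + Qᴴ * S) k1.symm k2.symm)
    simp only [conjTranspose_add, conjTranspose_mul, conjTranspose_conjTranspose, Matrix.add_mul,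
      Matrix.mul_assoc]
  refine ⟨B₁, D₁, B₁ᴴ * X + D₁ᴴ * Z, B₁ᴴ * Y + D₁ᴴ * W, hV', ?_, kX, kY, kZ, kW⟩
  rw [fromBlocks_conjTranspose_mul_self_eq_one_iff, gram X Z X Z q2, gram X Z Y W q4,
    gram Y W Y W q4]
  refine ⟨?_, ?_, ?_⟩
  · rw [← q3]; abel
  · rw [← q5]; abel
  · rw [← h3]; abel

end Cascade

/-! ### Factorisation along the characteristic polynomial -/

section IsRealized

variable {n : Type} [Fintype n] [DecidableEq n]

/-- On the unit disk, `Θ` is the transfer function of a finite-dimensional unitary colligation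
whose main operator has characteristic polynomial `p`. -/
def IsRealized (p : ℂ[X]) (Θ : ℂ → Matrix n n ℂ) : Prop :=
  ∃ (ι : Type) (_ : Fintype ι) (_ : DecidableEq ι) (M : Matrix ι ι ℂ) (B : Matrix ι n ℂ)
    (C : Matrix n ι ℂ) (D : Matrix n n ℂ),
    (fromBlocks M B C D)ᴴ * fromBlocks M B C D = 1 ∧ M.charpoly = p ∧
    ∀ z, ‖z‖ < 1 → IsTransferValue M B C D z (Θ z)

namespace IsRealized

variable {p q : ℂ[X]} {Θ Θ₁ Θ₂ : ℂ → Matrix n n ℂ}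

theorem posSemidef (h : IsRealized p Θ) {z : ℂ} (hz : ‖z‖ < 1) :
    (1 - Θ z * (Θ z)ᴴ).PosSemidef := by
  obtain ⟨ι, _, _, M, B, C, D, hU, -, hΘ⟩ := h
  exact (hΘ z hz).posSemidef hU hz

theorem differentiableOn (h : IsRealized p Θ) (a b : n) :
    DifferentiableOn ℂ (fun z => Θ z a b) (Metric.ball 0 1) := by
  obtain ⟨ι, _, _, M, B, C, D, hU, -, hΘ⟩ := h
  have hM := (fromBlocks_conjTranspose_mul_self_eq_one_iff.1 hU).1
  refine IsTransferValue.differentiableOn (fun z hz => ?_) (fun z hz => hΘ z ?_) a b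
  · exact det_one_sub_smul_ne_zero hM (by simpa using hz)
  · simpa using hz

theorem monic (h : IsRealized p Θ) : p.Monic := by
  obtain ⟨ι, _, _, M, B, C, D, -, rfl, -⟩ := h
  exact charpoly_monic M

/-- The determinant is determined up to a unimodular constant by the characteristic polynomial
of the main operator. -/
theorem exists_det_eq (h₁ : IsRealized p Θ₁) (h₂ : IsRealized p Θ₂) :
    ∃ c : ℂ, ‖c‖ = 1 ∧ ∀ z, ‖z‖ < 1 → (Θ₁ z).det = c * (Θ₂ z).det := by
  -- Apart from a unimodular constant, the determinant formula involves only `p`, and `p.reverse`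
  -- has no zeros in the disk, so it can be cancelled.
  have key : ∀ {Θ : ℂ → Matrix n n ℂ}, IsRealized p Θ → ∃ c : ℂ, ‖c‖ = 1 ∧
      ∀ z, ‖z‖ < 1 → p.reverse.eval z ≠ 0 ∧
        (Θ z).det * p.reverse.eval z = c * star (p.eval (star z)) := by
    rintro Θ ⟨ι, _, _, M, B, C, D, hU, rfl, hΘ⟩
    refine ⟨(-1) ^ Fintype.card ι * (fromBlocks M B C D).det, ?_, fun z hz => ⟨?_, ?_⟩⟩
    · have h1 := congrArg det hU
      rw [det_mul, det_conjTranspose, det_one] at h1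
      have h2 := congrArg norm h1
      rw [norm_mul, norm_star, norm_one] at h2
      rw [norm_mul, norm_pow, norm_neg, norm_one, one_pow, one_mul]
      nlinarith [norm_nonneg (fromBlocks M B C D).det]
    · rw [reverse_charpoly, eval_charpolyRev']
      exact det_one_sub_smul_ne_zero (fromBlocks_conjTranspose_mul_self_eq_one_iff.1 hU).1 hz
    · exact (hΘ z hz).det_mul_reverse_charpoly hU hz
  obtain ⟨c₁, hc₁, e₁⟩ := key h₁
  obtain ⟨c₂, hc₂, e₂⟩ := key h₂
  have hc₂0 : c₂ ≠ 0 := by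
    rintro rfl
    simp at hc₂
  refine ⟨c₁ / c₂, by rw [norm_div, hc₁, hc₂, div_one], fun z hz => ?_⟩
  obtain ⟨hr, e₁⟩ := e₁ z hz
  obtain ⟨-, e₂⟩ := e₂ z hz
  apply mul_right_cancel₀ hr
  rw [e₁, mul_assoc, e₂]
  field_simp

theorem mul (h₁ : IsRealized p Θ₁) (h₂ : IsRealized q Θ₂) :
    IsRealized (p * q) fun z => Θ₁ z * Θ₂ z := by
  obtain ⟨α, _, _, M₁, B₁, C₁, D₁, hU₁, rfl, hΘ₁⟩ := h₁
  obtain ⟨κ, _, _, M₂, B₂, C₂, D₂, hU₂, rfl, hΘ₂⟩ := h₂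
  exact ⟨α ⊕ κ, inferInstance, inferInstance, _, _, _, _, cascade_conjTranspose_mul_self hU₁ hU₂,
    charpoly_fromBlocks_zero₂₁ .., fun z hz => isTransferValue_cascade (hΘ₁ z hz) (hΘ₂ z hz)⟩

theorem one : IsRealized (1 : ℂ[X]) fun _ => (1 : Matrix n n ℂ) := by
  refine ⟨Empty, inferInstance, inferInstance, 0, 0, 0, 1, ?_, ?_, fun z _ => ⟨0, by simp, by simp⟩⟩
  · rw [fromBlocks_conjTranspose_mul_self_eq_one_iff]
    simp
    exact Subsingleton.elim _ _
  · simp [charpoly]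

/-- Splitting off an eigenvalue of the main operator as a left factor. -/
theorem exists_factor_of_isRoot (h : IsRealized p Θ) {μ : ℂ} (hμ : p.IsRoot μ) :
    ∃ (q : ℂ[X]) (Θ₁ Θ₂ : ℂ → Matrix n n ℂ), p = (X - Polynomial.C μ) * q ∧
      IsRealized (X - Polynomial.C μ) Θ₁ ∧ IsRealized q Θ₂ ∧
      ∀ z, ‖z‖ < 1 → Θ z = Θ₁ z * Θ₂ z := by
  obtain ⟨ι, _, _, M, B, C, D, hU, rfl, hΘ⟩ := h
  obtain ⟨a, b, c⟩ := fromBlocks_conjTranspose_mul_self_eq_one_iff.1 hU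
  rw [IsRoot, eval_charpoly] at hμ
  obtain ⟨v, hv0, hv⟩ := exists_mulVec_eq_zero_iff.2 hμ
  rw [sub_mulVec, sub_eq_zero] at hv
  have hs : (0 : ℂ) < star v ⬝ᵥ v := dotProduct_star_self_pos_iff.2 hv0
  obtain ⟨t, ht0, ht⟩ : ∃ t : ℝ, 0 < t ∧ star v ⬝ᵥ v = ((t ^ 2 : ℝ) : ℂ) := by
    have h1 := (Complex.lt_def.1 hs).1
    have h2 := (Complex.lt_def.1 hs).2
    simp only [Complex.zero_re, Complex.zero_im] at h1 h2
    refine ⟨Real.sqrt (star v ⬝ᵥ v).re, Real.sqrt_pos.2 h1, ?_⟩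
    rw [Real.sq_sqrt h1.le]
    exact Complex.ext (by simp) (by simp [← h2])
  have ht0' : (t : ℂ) ≠ 0 := by exact_mod_cast ht0.ne'
  -- A unit eigenvector, viewed as one isometric column, is the first vector of the basis that makes
  -- `M` block triangular.
  set V : Matrix ι Unit ℂ := of fun i _ => (t : ℂ)⁻¹ * v i with hVdef
  have hMV : M * V = μ • V := by
    ext i j
    have := congrFun hv i
    simp only [mulVec, dotProduct, scalar_apply, diagonal_apply, ite_mul, zero_mul,
      Finset.sum_ite_eq, Finset.mem_univ, if_true] at this
    simp only [hVdef, mul_apply, of_apply, Matrix.smul_apply, smul_eq_mul]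
    rw [mul_left_comm, this, Finset.mul_sum]
    exact Finset.sum_congr rfl fun _ _ => by ring
  have hVV : Vᴴ * V = 1 := by
    ext i j
    rw [one_apply, if_pos (Subsingleton.elim i j)]
    simp only [hVdef, mul_apply, conjTranspose_apply, of_apply]
    calc ∑ k, star ((t : ℂ)⁻¹ * v k) * ((t : ℂ)⁻¹ * v k)
        = ((t : ℂ)⁻¹ * (t : ℂ)⁻¹) * (star v ⬝ᵥ v) := by
          rw [dotProduct, Finset.mul_sum]
          refine Finset.sum_congr rfl fun k _ => ?_
          simp
          ring
      _ = 1 := by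
          rw [ht]
          push_cast
          field_simp
  have hne : Nonempty ι := by
    by_contra hι
    rw [not_nonempty_iff] at hι
    exact hv0 (Subsingleton.elim _ _)
  obtain ⟨V', hW₁, hW₂⟩ := exists_fromCols_unitary (β := Fin (Fintype.card ι - 1))
    (by simp; have := Fintype.card_pos (α := ι); omega) V hVV
  set W := fromCols V V' with hW
  have hV'V : V'ᴴ * V = 0 := by
    rw [hW, conjTranspose_fromCols_eq_fromRows_conjTranspose, fromRows_mul_fromCols,
      ← fromBlocks_one, fromBlocks_inj] at hW₁
    exact hW₁.2.2.1
  have hM : Wᴴ * M * W = fromBlocks (μ • 1) (Vᴴ * M * V') 0 (V'ᴴ * M * V') := by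
    rw [hW, conjTranspose_fromCols_eq_fromRows_conjTranspose, fromRows_mul, fromRows_mul_fromCols,
      Matrix.mul_assoc Vᴴ M V, Matrix.mul_assoc V'ᴴ M V, hMV, Matrix.mul_smul, Matrix.mul_smul,
      hVV, hV'V, smul_zero]
  have hcancel : ∀ {β : Type} (P : Matrix ι β ℂ), W * (Wᴴ * P) = P := by
    intro β P
    rw [← Matrix.mul_assoc, hW₂, Matrix.one_mul]
  have hU' : (fromBlocks (Wᴴ * M * W) (Wᴴ * B) (C * W) D)ᴴ *
      fromBlocks (Wᴴ * M * W) (Wᴴ * B) (C * W) D = 1 := by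
    rw [fromBlocks_conjTranspose_mul_self_eq_one_iff]
    simp only [conjTranspose_mul, conjTranspose_conjTranspose, Matrix.mul_assoc, hcancel]
    refine ⟨?_, ?_, c⟩
    · rw [← Matrix.mul_add, ← Matrix.mul_assoc Mᴴ, ← Matrix.mul_assoc Cᴴ, ← Matrix.add_mul, a,
        Matrix.one_mul, hW₁]
    · rw [← Matrix.mul_add, b, Matrix.mul_zero]
  have hΘ' : ∀ z, ‖z‖ < 1 → IsTransferValue (Wᴴ * M * W) (Wᴴ * B) (C * W) D z (Θ z) := by
    intro z hz
    obtain ⟨X, hX, hΘX⟩ := hΘ z hz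
    refine ⟨Wᴴ * X, ?_, ?_⟩
    · rw [Matrix.mul_assoc, hcancel, Matrix.mul_assoc, ← Matrix.mul_smul, ← Matrix.mul_add, ← hX]
    · rw [Matrix.mul_assoc, hcancel, hΘX]
  -- `W` has differently typed index sets of equal cardinality, so the equal powers of `X` in
  -- `charpoly_mul_comm'` cancel.
  have hchar : (Wᴴ * M * W).charpoly = M.charpoly := by
    have := charpoly_mul_comm' (Wᴴ * M) W
    rw [← Matrix.mul_assoc, hW₂, Matrix.one_mul] at this
    have hcard : Fintype.card ι = Fintype.card (Unit ⊕ Fin (Fintype.card ι - 1)) := by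
      simp; have := Fintype.card_pos (α := ι); omega
    rw [← hcard] at this
    exact mul_left_cancel₀ (pow_ne_zero _ X_ne_zero) this
  rw [hM] at hU' hΘ' hchar
  rw [← fromRows_toRows (Wᴴ * B), ← fromCols_toCols (C * W)] at hU' hΘ'
  obtain ⟨B₁, D₁, C₂, D₂, hU₁, hU₂, e1, e2, e3, e4⟩ := exists_cascade_of_block_triangular hU'
  rw [e1, e2, e3, e4] at hΘ'
  have d₁ := (fromBlocks_conjTranspose_mul_self_eq_one_iff.1 hU₁).1
  have d₂ := (fromBlocks_conjTranspose_mul_self_eq_one_iff.1 hU₂).1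
  have t₁ := fun z (hz : ‖z‖ < 1) => (isTransferValue_iff (B := B₁) (C := (C * W).toCols₁)
    (D := D₁) (det_one_sub_smul_ne_zero d₁ hz)).2 rfl
  have t₂ := fun z (hz : ‖z‖ < 1) => (isTransferValue_iff (B := (Wᴴ * B).toRows₂) (C := C₂)
    (D := D₂) (det_one_sub_smul_ne_zero d₂ hz)).2 rfl
  have hμ1 : (μ • (1 : Matrix Unit Unit ℂ)).charpoly = X - Polynomial.C μ := by
    simp [charpoly, charmatrix]
  refine ⟨(V'ᴴ * M * V').charpoly, _, _, ?_,
    ⟨_, _, _, _, _, _, _, hU₁, hμ1, t₁⟩, ⟨_, _, _, _, _, _, _, hU₂, rfl, t₂⟩, fun z hz => ?_⟩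
  · rw [← hchar, charpoly_fromBlocks_zero₂₁, hμ1]
  · have hd := det_one_sub_smul_ne_zero (fromBlocks_conjTranspose_mul_self_eq_one_iff.1
      (cascade_conjTranspose_mul_self hU₁ hU₂)).1 hz
    rw [(isTransferValue_iff hd).1 (hΘ' z hz),
      (isTransferValue_iff hd).1 (isTransferValue_cascade (t₁ z hz) (t₂ z hz))]

/-- Roots of `p` are peeled off one at a time as left factors and reassembled by cascading. No order
of the eigenvalues is prescribed, so any monic divisor can be placed on the left. -/
theorem exists_factor (hp : p.Monic) (h : IsRealized (p * q) Θ) :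
    ∃ Θ₁ Θ₂ : ℂ → Matrix n n ℂ, IsRealized p Θ₁ ∧ IsRealized q Θ₂ ∧
      ∀ z, ‖z‖ < 1 → Θ z = Θ₁ z * Θ₂ z := by
  induction hd : p.natDegree generalizing p Θ with
  | zero =>
    obtain rfl := hp.natDegree_eq_zero.1 hd
    rw [one_mul] at h
    exact ⟨fun _ => 1, Θ, one, h, fun z _ => (Matrix.one_mul _).symm⟩
  | succ d ih =>
    obtain ⟨μ, hμ⟩ := IsAlgClosed.exists_root p (by
      rw [degree_eq_natDegree hp.ne_zero, hd]; exact_mod_cast d.succ_ne_zero)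
    obtain ⟨r, rfl⟩ := dvd_iff_isRoot.2 hμ
    have hr : r.Monic := (monic_X_sub_C μ).of_mul_monic_left hp
    obtain ⟨s, Φ, Ψ, hs, hΦ, hΨ, e⟩ := h.exists_factor_of_isRoot (μ := μ) (by simp)
    rw [mul_assoc] at hs
    obtain rfl := mul_left_cancel₀ (X_sub_C_ne_zero μ) hs
    have hrd : r.natDegree = d := by
      rw [(monic_X_sub_C μ).natDegree_mul hr, natDegree_X_sub_C] at hd
      omega
    obtain ⟨Φ', Ψ', h₁, h₂, e'⟩ := ih hr hΨ hrd
    refine ⟨fun z => Φ z * Φ' z, Ψ', hΦ.mul h₁, h₂, fun z hz => ?_⟩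
    rw [e z hz, e' z hz, Matrix.mul_assoc]

/-- The product is realized with polynomial `p * q = q * p`, so it can be cut again with `q` on the
left. -/
theorem exists_swap (h₁ : IsRealized p Θ₁) (h₂ : IsRealized q Θ₂) :
    ∃ Φ₁ Φ₂ : ℂ → Matrix n n ℂ, IsRealized p Φ₁ ∧ IsRealized q Φ₂ ∧
      ∀ z, ‖z‖ < 1 → Θ₁ z * Θ₂ z = Φ₂ z * Φ₁ z := by
  have h := h₁.mul h₂
  rw [mul_comm] at h
  obtain ⟨Φ₂, Φ₁, hΦ₂, hΦ₁, e⟩ := exists_factor h₂.monic h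
  exact ⟨Φ₁, Φ₂, hΦ₁, hΦ₂, e⟩

end IsRealized

end IsRealized

/-- The hypothesis says `‖Xᴴ v‖ = ‖Yᴴ v‖` for all `v`. Hence `Yᴴ v ↦ Xᴴ v` is a well-defined
isometry on the range of `Yᴴ`; it extends to the whole space, and `U` is the adjoint of the
extension. -/
theorem Matrix.exists_unitary_of_mul_conjTranspose_eq {p q : Type*} [Fintype p] [Fintype q]
    [DecidableEq p] [DecidableEq q] {X Y : Matrix p q ℂ} (h : X * Xᴴ = Y * Yᴴ) :
    ∃ U : Matrix q q ℂ, Uᴴ * U = 1 ∧ X = Y * U := by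
  let f := toEuclideanLin Xᴴ
  let g := toEuclideanLin Yᴴ
  have hn : ∀ (Z : Matrix p q ℂ) (v : EuclideanSpace ℂ p),
      ((‖toEuclideanLin Zᴴ v‖ ^ 2 : ℝ) : ℂ) = star v.ofLp ⬝ᵥ (Z * Zᴴ) *ᵥ v.ofLp := by
    intro Z v
    rw [← mulVec_mulVec, dotProduct_mulVec, ← conjTranspose_conjTranspose Z, ← star_mulVec,
      conjTranspose_conjTranspose]
    have := inner_self_eq_norm_sq_to_K (𝕜 := ℂ) (toEuclideanLin Zᴴ v)
    push_cast
    refine Eq.trans this.symm ?_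
    rw [EuclideanSpace.inner_eq_star_dotProduct, dotProduct_comm]
    rfl
  have hfg : ∀ v, ‖f v‖ = ‖g v‖ := by
    intro v
    have h1 := (hn X v).trans ((by rw [h]) : _ = _) |>.trans (hn Y v).symm
    have h2 : ‖f v‖ ^ 2 = ‖g v‖ ^ 2 := by exact_mod_cast h1
    exact (sq_eq_sq₀ (norm_nonneg _) (norm_nonneg _)).1 h2
  -- The choice of the section `s` is immaterial, because equality of norms makes `f` vanish on the
  -- kernel of `g`.
  obtain ⟨s, hs⟩ := g.rangeRestrict.exists_rightInverse_of_surjective g.range_rangeRestrict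
  have hs' : ∀ y : LinearMap.range g, g (s y) = y := fun y =>
    congrArg Subtype.val (LinearMap.congr_fun hs y)
  let L : LinearMap.range g →ₗᵢ[ℂ] EuclideanSpace ℂ q :=
    { toLinearMap := f ∘ₗ s
      norm_map' := fun y => by
        rw [LinearMap.comp_apply, hfg, hs']
        rfl }
  have hL : ∀ v, L.extend (g v) = f v := by
    intro v
    have h1 := L.extend_apply ⟨g v, v, rfl⟩
    refine h1.trans ?_
    change f (s ⟨g v, v, rfl⟩) = f v
    rw [← sub_eq_zero, ← map_sub, ← norm_eq_zero, hfg, map_sub, hs', sub_self, norm_zero]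
  set R : Matrix q q ℂ := toEuclideanLin.symm L.extend.toLinearMap with hR
  have hR' : ∀ v, toEuclideanLin R v = L.extend v := by
    intro v
    rw [hR, LinearEquiv.apply_symm_apply]
    rfl
  have hRR : Rᴴ * R = 1 := by
    ext i j
    have h1 := L.extend.inner_map_map (EuclideanSpace.single i 1) (EuclideanSpace.single j 1)
    have h2 : ∀ k l : q, toEuclideanLin R (EuclideanSpace.single k 1) l = R l k := by
      intro k l
      simp [toLpLin_apply]
    have h3 := orthonormal_iff_ite.1 (EuclideanSpace.orthonormal_single (𝕜 := ℂ) (ι := q)) i j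
    rw [h3, ← hR', ← hR', PiLp.inner_apply] at h1
    simp only [h2, RCLike.inner_apply'] at h1
    rw [mul_apply, one_apply, ← h1]
    rfl
  refine ⟨Rᴴ, by rw [conjTranspose_conjTranspose]; exact mul_eq_one_comm.1 hRR, ?_⟩
  have hRY : R * Yᴴ = Xᴴ := by
    apply toEuclideanLin.injective
    ext v : 1
    have : toEuclideanLin (R * Yᴴ) v = toEuclideanLin R (toEuclideanLin Yᴴ v) := by
      simp [toLpLin_apply]
    rw [this, hR']
    exact hL v
  rw [← conjTranspose_conjTranspose X, ← hRY, conjTranspose_mul, conjTranspose_conjTranspose]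

/-! ### Contractivity of truncated Toeplitz matrices, via Fourier series -/

section Bessel

open MeasureTheory AddCircle

theorem norm_toLp_sq (f : C(UnitAddCircle, ℂ)) :
    ‖ContinuousMap.toLp (E := ℂ) 2 haarAddCircle ℂ f‖ ^ 2 =
      ∫ t : UnitAddCircle, ‖f t‖ ^ 2 ∂haarAddCircle := by
  have h := ContinuousMap.inner_toLp (𝕜 := ℂ) (haarAddCircle (T := (1 : ℝ))) f f
  rw [inner_self_eq_norm_sq_to_K] at h
  have h2 : ∀ t, f t * (starRingEnd ℂ) (f t) = ((‖f t‖ ^ 2 : ℝ) : ℂ) := by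
    intro t
    simpa using Complex.mul_conj' (f t)
  simp only [h2] at h
  rw [integral_complex_ofReal] at h
  norm_cast at h
  exact Complex.ofReal_injective h

/-- Conjugation turns the expansion of α into frequencies `k - i` with `i ≥ 0`; frequency `j` occurs
only for `i = k - j`. -/
theorem inner_fourierLp_star_mul {c : ℕ → ℂ} {α : C(UnitAddCircle, ℂ)}
    (hα : HasSum (fun i : ℕ => c i • fourier (T := (1 : ℝ)) i) α) (j k : ℕ) :
    inner ℂ (fourierLp (T := (1 : ℝ)) 2 j)
      (ContinuousMap.toLp (E := ℂ) 2 haarAddCircle ℂ (star α * fourier k)) =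
      if j ≤ k then star (c (k - j)) else 0 := by
  have h1 : HasSum (fun i : ℕ => star (c i) • fourier (T := (1 : ℝ)) ((k : ℤ) - i))
      (star α * fourier k) := by
    have e : ∀ i : ℕ, star (c i) • fourier (T := (1 : ℝ)) ((k : ℤ) - i) =
        star (c i • fourier (T := (1 : ℝ)) i) * fourier k := by
      intro i
      ext t
      rw [sub_eq_neg_add]
      simp only [ContinuousMap.smul_apply, ContinuousMap.mul_apply, ContinuousMap.star_apply,
        fourier_add, fourier_neg, star_smul, smul_eq_mul, mul_assoc, Complex.star_def]
    simp only [e]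
    exact hα.star.mul_right (fourier (T := (1 : ℝ)) k)
  have h2 := (h1.mapL (ContinuousMap.toLp (E := ℂ) 2 haarAddCircle ℂ)).mapL
    (innerSL ℂ (fourierLp (T := (1 : ℝ)) 2 j))
  have h3 : ∀ i : ℕ, innerSL ℂ (fourierLp (T := (1 : ℝ)) 2 j)
      (ContinuousMap.toLp (E := ℂ) 2 haarAddCircle ℂ
        (star (c i) • fourier (T := (1 : ℝ)) ((k : ℤ) - i))) =
      if (j : ℤ) = k - i then star (c i) else 0 := by
    intro i
    have := orthonormal_iff_ite.1 (orthonormal_fourier (T := (1 : ℝ))) j (k - i)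
    rw [map_smul, map_smul, innerSL_apply_apply]
    change _ • inner ℂ (fourierLp (T := (1 : ℝ)) 2 j) (fourierLp (T := (1 : ℝ)) 2 ((k : ℤ) - i)) = _
    rw [this]
    simp
  simp only [h3] at h2
  rw [innerSL_apply_apply] at h2
  refine h2.unique ?_
  split_ifs with hjk
  · have e : (fun i : ℕ => if (j : ℤ) = k - i then star (c i) else 0) =
        fun i => if i = k - j then star (c (k - j)) else 0 := by
      funext i
      by_cases hi : i = k - j
      · subst hi
        rw [if_pos (by omega), if_pos rfl]
      · rw [if_neg (by omega), if_neg hi]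
    rw [e]
    exact hasSum_ite_eq (k - j) (star (c (k - j)))
  · have e : (fun i : ℕ => if (j : ℤ) = k - i then star (c i) else 0) = fun _ => 0 := by
      funext i
      rw [if_neg (by omega)]
    rw [e]
    exact hasSum_zero

theorem re_star_dotProduct_self {l : Type*} [Fintype l] (w : l → ℂ) :
    (star w ⬝ᵥ w).re = ∑ i, ‖w i‖ ^ 2 := by
  rw [dotProduct, Complex.re_sum]
  refine Finset.sum_congr rfl fun i _ => ?_
  rw [Pi.star_apply, Complex.star_def, Complex.conj_mul']
  norm_cast

theorem sum_norm_sq_conjTranspose_mulVec_le {m n : Type*} [Fintype m] [Fintype n] [DecidableEq m]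
    {A : Matrix m n ℂ} (hA : (1 - A * Aᴴ).PosSemidef) (v : m → ℂ) :
    ∑ b, ‖(Aᴴ *ᵥ v) b‖ ^ 2 ≤ ∑ a, ‖v a‖ ^ 2 := by
  have h := (Complex.le_def.1 (hA.dotProduct_mulVec_nonneg v)).1
  rw [sub_mulVec, one_mulVec, dotProduct_sub, ← mulVec_mulVec, dotProduct_mulVec _ A,
    ← conjTranspose_conjTranspose A, ← star_mulVec, conjTranspose_conjTranspose, Complex.sub_re,
    re_star_dotProduct_self, re_star_dotProduct_self, Complex.zero_re] at h
  linarith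

/-- Contractivity of the truncated block Toeplitz matrix of a contractive analytic function,
damped by `r < 1`. -/
theorem toeplitz_bessel_of_lt_one {n : Type*} [Fintype n] [DecidableEq n] {N : ℕ}
    {A : ℂ → Matrix n n ℂ} {a : ℕ → Matrix n n ℂ}
    (hsum : ∀ z, ‖z‖ < 1 → ∀ i j, HasSum (fun k => z ^ k * a k i j) (A z i j))
    (hA : ∀ z, ‖z‖ < 1 → (1 - A z * (A z)ᴴ).PosSemidef) {r : ℝ} (hr0 : 0 ≤ r) (hr1 : r < 1)
    (x : Fin N → n → ℂ) :
    ∑ j : Fin N, ∑ b, ‖∑ i : Fin N, ∑ c, (if j ≤ i then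
      star ((r : ℂ) ^ ((i : ℕ) - j) * a (i - j) c b) else 0) * x i c‖ ^ 2 ≤
      ∑ i, ∑ c, ‖x i c‖ ^ 2 := by
  have hr : ‖(r : ℂ)‖ < 1 := by simpa [abs_of_nonneg hr0] using hr1
  -- Damping by `r < 1` makes the coefficients absolutely summable, so the symbol is continuous on
  -- the circle.
  have hα : ∀ c b, ∃ α : C(UnitAddCircle, ℂ),
      HasSum (fun i : ℕ => ((r : ℂ) ^ i * a i c b) • fourier (T := (1 : ℝ)) i) α := by
    intro c b
    refine (Summable.of_norm ?_)
    refine ((hsum r hr c b).summable.norm).congr fun i => ?_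
    rw [norm_smul, fourier_norm, mul_one]
  choose α hα using hα
  have hball : ∀ t, ‖(r : ℂ) * fourier (T := (1 : ℝ)) 1 t‖ < 1 := by
    intro t
    rw [norm_mul, fourier_apply, Circle.norm_coe, mul_one]
    exact hr
  have hαt : ∀ c b t, α c b t = A (r * fourier (T := (1 : ℝ)) 1 t) c b := by
    intro c b t
    have h1 := (hα c b).mapL (ContinuousMap.evalCLM ℂ t)
    refine h1.unique ?_
    convert hsum _ (hball t) c b using 2 with i
    simp only [ContinuousMap.evalCLM_apply, ContinuousMap.smul_apply, smul_eq_mul, mul_pow]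
    rw [show fourier (T := (1 : ℝ)) (i : ℤ) t = fourier (T := (1 : ℝ)) 1 t ^ i by
      rw [fourier_apply, fourier_apply, one_zsmul, toCircle_zsmul, zpow_natCast, Circle.coe_pow]]
    ring
  -- The vector `x` is encoded as a trigonometric polynomial Ξ, and `Y` is `Aᴴ` applied to it
  -- pointwise. Contractivity bounds the norm of `Y` in L², and Bessel's inequality retains only the
  -- frequencies `0, …, N - 1`.
  let Ξ : n → C(UnitAddCircle, ℂ) := fun c => ∑ i : Fin N, x i c • fourier (T := (1 : ℝ)) (i : ℕ)
  let Y : n → C(UnitAddCircle, ℂ) := fun b => ∑ c, star (α c b) * Ξ c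
  let ι := ContinuousMap.toLp (E := ℂ) 2 (haarAddCircle (T := (1 : ℝ))) ℂ
  have hsq_int : ∀ f : C(UnitAddCircle, ℂ),
      Integrable (fun t => ‖f t‖ ^ 2) (haarAddCircle (T := (1 : ℝ))) := fun f =>
    Continuous.integrable_of_hasCompactSupport (by fun_prop) (HasCompactSupport.of_compactSpace _)
  have h1 : ∑ b, ‖ι (Y b)‖ ^ 2 ≤ ∑ c, ‖ι (Ξ c)‖ ^ 2 := by
    simp only [ι, norm_toLp_sq]
    rw [← integral_finsetSum _ fun b _ => hsq_int (Y b), ← integral_finsetSum _ fun c _ => hsq_int (Ξ c)]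
    refine integral_mono (integrable_finsetSum _ fun b _ => hsq_int (Y b))
      (integrable_finsetSum _ fun c _ => hsq_int (Ξ c)) fun t => ?_
    have := sum_norm_sq_conjTranspose_mulVec_le (hA _ (hball t)) fun c => Ξ c t
    have e : ∀ b, Y b t = ((A (r * fourier (T := (1 : ℝ)) 1 t))ᴴ *ᵥ fun c => Ξ c t) b := by
      intro b
      simp only [Y, mulVec, dotProduct, conjTranspose_apply, ← hαt, ContinuousMap.sum_apply,
        ContinuousMap.mul_apply, ContinuousMap.star_apply]
    simpa only [e] using this
  have h2 : ∀ c, ‖ι (Ξ c)‖ ^ 2 = ∑ i, ‖x i c‖ ^ 2 := by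
    intro c
    have hon : Orthonormal ℂ fun i : Fin N => fourierLp (T := (1 : ℝ)) 2 ((i : ℕ) : ℤ) :=
      orthonormal_fourier.comp (fun i : Fin N => ((i : ℕ) : ℤ)) fun i j h => by
        simpa [Fin.ext_iff] using h
    have e : ι (Ξ c) = ∑ i : Fin N, x i c • fourierLp (T := (1 : ℝ)) 2 ((i : ℕ) : ℤ) := by
      simp only [Ξ, map_sum, map_smul]
      rfl
    have := hon.inner_sum (fun i => x i c) (fun i => x i c) Finset.univ
    rw [← e, inner_self_eq_norm_sq_to_K] at this
    have h3 : ∀ i, (starRingEnd ℂ) (x i c) * x i c = ((‖x i c‖ ^ 2 : ℝ) : ℂ) := fun i => by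
      simpa using Complex.conj_mul' (x i c)
    simp only [h3] at this
    norm_cast at this
    exact Complex.ofReal_injective this
  have h3 : ∀ (j : Fin N) b, inner ℂ (fourierLp (T := (1 : ℝ)) 2 ((j : ℕ) : ℤ)) (ι (Y b)) =
      ∑ i : Fin N, ∑ c, (if j ≤ i then
      star ((r : ℂ) ^ ((i : ℕ) - j) * a (i - j) c b) else 0) * x i c := by
    intro j b
    have e : Y b = ∑ i : Fin N, ∑ c, x i c • (star (α c b) * fourier (T := (1 : ℝ)) (i : ℕ)) := by
      simp only [Y, Ξ, Finset.mul_sum]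
      rw [Finset.sum_comm]
      simp only [mul_smul_comm]
    rw [e]
    simp only [map_sum, map_smul, inner_sum, inner_smul_right, ι]
    refine Finset.sum_congr rfl fun i _ => Finset.sum_congr rfl fun c _ => ?_
    rw [inner_fourierLp_star_mul (hα c b) j i, mul_comm]
    simp only [Fin.le_def]
  have h4 : ∀ b, ∑ j : Fin N, ‖inner ℂ (fourierLp (T := (1 : ℝ)) 2 ((j : ℕ) : ℤ)) (ι (Y b))‖ ^ 2 ≤
      ‖ι (Y b)‖ ^ 2 := by
    intro b
    have hon : Orthonormal ℂ fun i : Fin N => fourierLp (T := (1 : ℝ)) 2 ((i : ℕ) : ℤ) :=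
      orthonormal_fourier.comp (fun i : Fin N => ((i : ℕ) : ℤ)) fun i j h => by
        simpa [Fin.ext_iff] using h
    exact hon.sum_inner_products_le (s := Finset.univ) (ι (Y b))
  calc _ = ∑ b, ∑ j : Fin N,
        ‖inner ℂ (fourierLp (T := (1 : ℝ)) 2 ((j : ℕ) : ℤ)) (ι (Y b))‖ ^ 2 := by
        rw [Finset.sum_comm]
        simp only [h3]
    _ ≤ ∑ b, ‖ι (Y b)‖ ^ 2 := Finset.sum_le_sum fun b _ => h4 b
    _ ≤ ∑ c, ‖ι (Ξ c)‖ ^ 2 := h1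
    _ = _ := by
        simp only [h2]
        rw [Finset.sum_comm]

/-- For fixed `N` the damped expression is a finite sum, continuous in `r`, so the bound survives `r
→ 1`. -/
theorem toeplitz_bessel {n : Type*} [Fintype n] [DecidableEq n] {N : ℕ}
    {A : ℂ → Matrix n n ℂ} {a : ℕ → Matrix n n ℂ}
    (hsum : ∀ z, ‖z‖ < 1 → ∀ i j, HasSum (fun k => z ^ k * a k i j) (A z i j))
    (hA : ∀ z, ‖z‖ < 1 → (1 - A z * (A z)ᴴ).PosSemidef) (x : Fin N → n → ℂ) :
    ∑ j : Fin N, ∑ b, ‖∑ i : Fin N, ∑ c, (if j ≤ i then star (a (i - j) c b) else 0) * x i c‖ ^ 2 ≤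
      ∑ i, ∑ c, ‖x i c‖ ^ 2 := by
  let F : ℝ → ℝ := fun r => ∑ j : Fin N, ∑ b, ‖∑ i : Fin N, ∑ c, (if j ≤ i then
      star ((r : ℂ) ^ ((i : ℕ) - j) * a (i - j) c b) else 0) * x i c‖ ^ 2
  have hF : Continuous F := by
    refine continuous_finsetSum _ fun j _ => continuous_finsetSum _ fun b _ =>
      (continuous_norm.comp (continuous_finsetSum _ fun i _ => continuous_finsetSum _ fun c _ =>
        Continuous.mul ?_ continuous_const)).pow 2
    split_ifs
    · fun_prop
    · exact continuous_const
  have hF1 : Filter.Tendsto F (nhdsWithin 1 (Set.Iio 1)) (nhds (F 1)) :=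
    hF.continuousAt.tendsto.mono_left nhdsWithin_le_nhds
  have hle : F 1 ≤ ∑ i, ∑ c, ‖x i c‖ ^ 2 := by
    refine le_of_tendsto hF1 ?_
    filter_upwards [Ioo_mem_nhdsLT (show (0 : ℝ) < 1 by norm_num)] with r hr
    exact toeplitz_bessel_of_lt_one hsum hA hr.1.le hr.2 x
  simpa [F] using hle

end Bessel

open scoped MatrixOrder in
theorem Matrix.PosSemidef.exists_eq_mul_conjTranspose {m : Type*} [Fintype m] [DecidableEq m]
    {P : Matrix m m ℂ} (hP : P.PosSemidef) : ∃ G : Matrix m m ℂ, P = G * Gᴴ := by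
  obtain ⟨B, rfl⟩ := CStarAlgebra.nonneg_iff_eq_star_mul_self.mp hP.nonneg
  exact ⟨Bᴴ, by rw [conjTranspose_conjTranspose, star_eq_conjTranspose]⟩

/-! ### Realization of Taylor polynomials by a lurking isometry -/

section Toeplitz

variable {n : Type} [Fintype n] [DecidableEq n]

/-- The truncated lower triangular block Toeplitz matrix with symbol coefficients `a`. -/
def blockToeplitz (a : ℕ → Matrix n n ℂ) (N : ℕ) : Matrix (Fin N × n) (Fin N × n) ℂ :=
  of fun i j => if j.1 ≤ i.1 then a (i.1 - j.1) i.2 j.2 else 0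

/-- The block lower shift. -/
def blockShift (n : Type) [DecidableEq n] (N : ℕ) : Matrix (Fin N × n) (Fin N × n) ℂ :=
  of fun i j => if (i.1 : ℕ) = j.1 + 1 ∧ i.2 = j.2 then 1 else 0

/-- The inclusion of the initial block. -/
def blockFirst (n : Type) [DecidableEq n] (N : ℕ) : Matrix (Fin N × n) n ℂ :=
  of fun i j => if (i.1 : ℕ) = 0 ∧ i.2 = j then 1 else 0

/-- The block row `(1, z, …, z ^ (N - 1))`. -/
def blockMonomials (n : Type) [DecidableEq n] (N : ℕ) (z : ℂ) : Matrix n (Fin N × n) ℂ :=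
  of fun i j => if i = j.2 then z ^ (j.1 : ℕ) else 0

/-- The projection to the final block. -/
def blockLast (n : Type) [DecidableEq n] (N : ℕ) : Matrix n (Fin N × n) ℂ :=
  of fun i j => if (j.1 : ℕ) + 1 = N ∧ i = j.2 then 1 else 0

theorem blockShift_mul_apply_zero {β : Type*} {N : ℕ} (P : Matrix (Fin N × n) β ℂ) (k : Fin N)
    (hk : (k : ℕ) = 0) (c : n) (b : β) : (blockShift n N * P) (k, c) b = 0 := by
  rw [mul_apply]
  refine Finset.sum_eq_zero fun x _ => ?_
  simp [blockShift, hk]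

theorem blockShift_mul_apply_succ {β : Type*} {N : ℕ} (P : Matrix (Fin N × n) β ℂ) (k l : Fin N)
    (hk : (k : ℕ) = l + 1) (c : n) (b : β) : (blockShift n N * P) (k, c) b = P (l, c) b := by
  rw [mul_apply, Finset.sum_eq_single (l, c)]
  · simp [blockShift, hk]
  · rintro ⟨x, y⟩ _ hxy
    have : ¬((k : ℕ) = x + 1 ∧ c = y) := by
      rintro ⟨h1, rfl⟩
      exact hxy (by rw [show x = l from Fin.ext (by omega)])
    simp [blockShift, this]
  · simp

theorem mul_blockShift_apply_last {β : Type*} {N : ℕ} (P : Matrix β (Fin N × n) ℂ) (k : Fin N)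
    (hk : (k : ℕ) + 1 = N) (c : n) (b : β) : (P * blockShift n N) b (k, c) = 0 := by
  rw [mul_apply]
  refine Finset.sum_eq_zero fun x _ => ?_
  have : ¬((x.1 : ℕ) = k + 1 ∧ x.2 = c) := by
    rintro ⟨h, -⟩
    omega
  simp [blockShift, this]

theorem mul_blockShift_apply_succ {β : Type*} {N : ℕ} (P : Matrix β (Fin N × n) ℂ) (k l : Fin N)
    (hk : (l : ℕ) = k + 1) (c : n) (b : β) : (P * blockShift n N) b (k, c) = P b (l, c) := by
  rw [mul_apply, Finset.sum_eq_single (l, c)]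
  · simp [blockShift, hk]
  · rintro ⟨x, y⟩ _ hxy
    have : ¬((x : ℕ) = k + 1 ∧ y = c) := by
      rintro ⟨h1, rfl⟩
      exact hxy (by rw [show x = l from Fin.ext (by omega)])
    simp [blockShift, this]
  · simp

theorem mul_blockFirst_apply {β : Type*} {N : ℕ} (P : Matrix β (Fin (N + 1) × n) ℂ) (b : β)
    (c : n) : (P * blockFirst n (N + 1)) b c = P b (0, c) := by
  rw [mul_apply, Finset.sum_eq_single (0, c)]
  · simp [blockFirst]
  · rintro ⟨x, y⟩ _ hxy
    have : ¬((x : ℕ) = 0 ∧ y = c) := by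
      rintro ⟨h1, rfl⟩
      exact hxy (by rw [show x = 0 from Fin.ext h1])
    simp only [blockFirst, of_apply, if_neg this, mul_zero]
  · simp

theorem blockShift_mul_blockToeplitz (a : ℕ → Matrix n n ℂ) (N : ℕ) :
    blockShift n N * blockToeplitz a N = blockToeplitz a N * blockShift n N := by
  ext ⟨k, c⟩ ⟨l, d⟩
  have hL : (blockShift n N * blockToeplitz a N) (k, c) (l, d) =
      if (l : ℕ) + 1 ≤ k then a (k - (l + 1)) c d else 0 := by
    by_cases hk : (k : ℕ) = 0
    · rw [blockShift_mul_apply_zero _ _ hk, if_neg (by omega)]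
    · rw [blockShift_mul_apply_succ _ k ⟨k - 1, by omega⟩ (by simp; omega)]
      simp only [blockToeplitz, of_apply, Fin.le_def]
      by_cases h : (l : ℕ) + 1 ≤ k
      · rw [if_pos h, if_pos (by omega)]
        congr 1
        omega
      · rw [if_neg h, if_neg (by omega)]
  have hR : (blockToeplitz a N * blockShift n N) (k, c) (l, d) =
      if (l : ℕ) + 1 ≤ k then a (k - (l + 1)) c d else 0 := by
    by_cases hl : (l : ℕ) + 1 = N
    · rw [mul_blockShift_apply_last _ _ hl, if_neg (by omega)]
    · rw [mul_blockShift_apply_succ _ l ⟨l + 1, by omega⟩ rfl]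
      simp only [blockToeplitz, of_apply, Fin.le_def]
  rw [hL, hR]

theorem blockShift_mul_conjTranspose_add (N : ℕ) :
    blockShift n (N + 1) * (blockShift n (N + 1))ᴴ +
      blockFirst n (N + 1) * (blockFirst n (N + 1))ᴴ = 1 := by
  ext ⟨k, c⟩ ⟨l, d⟩
  rw [Matrix.add_apply, one_apply]
  have h2 : (blockFirst n (N + 1) * (blockFirst n (N + 1))ᴴ) (k, c) (l, d) =
      if (k : ℕ) = 0 ∧ (l : ℕ) = 0 ∧ c = d then 1 else 0 := by
    rw [mul_apply, Finset.sum_eq_single c]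
    · simp only [blockFirst, conjTranspose_apply, of_apply, and_true]
      split_ifs <;> simp_all
    · intro b _ hb
      simp [blockFirst, Ne.symm hb]
    · simp
  rw [h2]
  by_cases hk : (k : ℕ) = 0
  · rw [blockShift_mul_apply_zero _ _ hk, zero_add]
    refine if_congr ?_ rfl rfl
    simp only [Prod.mk.injEq, Fin.ext_iff]
    constructor
    · rintro ⟨_, h, rfl⟩
      exact ⟨by omega, rfl⟩
    · rintro ⟨h, rfl⟩
      exact ⟨hk, by omega, rfl⟩
  · rw [blockShift_mul_apply_succ _ k ⟨k - 1, by omega⟩ (by simp; omega), if_neg (by tauto),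
      add_zero, conjTranspose_apply]
    simp only [blockShift, of_apply, apply_ite star, star_one, star_zero]
    refine if_congr ?_ rfl rfl
    simp only [Prod.mk.injEq, Fin.ext_iff]
    constructor
    · rintro ⟨h, rfl⟩
      exact ⟨by omega, rfl⟩
    · rintro ⟨h, rfl⟩
      exact ⟨by omega, rfl⟩

/-- The monomial row is a left eigenvector of the shift except in the last block; this defect is the
only source of error in the approximation. -/
theorem blockMonomials_mul_blockShift (N : ℕ) (z : ℂ) :
    blockMonomials n N z * blockShift n N = z • blockMonomials n N z - z ^ N • blockLast n N := by
  ext b ⟨k, c⟩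
  simp only [Matrix.sub_apply, Matrix.smul_apply, smul_eq_mul]
  by_cases hk : (k : ℕ) + 1 = N
  · rw [mul_blockShift_apply_last _ _ hk]
    simp only [blockMonomials, blockLast, of_apply, hk, true_and]
    split_ifs
    · rw [← pow_succ', hk]; ring
    · ring
  · rw [mul_blockShift_apply_succ _ k ⟨k + 1, by omega⟩ rfl]
    simp only [blockMonomials, blockLast, of_apply, hk, false_and, if_false, mul_zero, sub_zero,
      mul_ite]
    rw [pow_succ']

theorem blockMonomials_mul_blockFirst (N : ℕ) (z : ℂ) :
    blockMonomials n (N + 1) z * blockFirst n (N + 1) = 1 := by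
  ext b c
  rw [mul_blockFirst_apply]
  simp [blockMonomials, one_apply]

theorem blockMonomials_mul_apply {β : Type*} (N : ℕ) (z : ℂ) (P : Matrix (Fin N × n) β ℂ) (b : n)
    (c : β) : (blockMonomials n N z * P) b c = ∑ k : Fin N, z ^ (k : ℕ) * P (k, b) c := by
  rw [mul_apply, Fintype.sum_prod_type]
  simp [blockMonomials]

theorem blockMonomials_mul_blockToeplitz_mul_blockFirst (a : ℕ → Matrix n n ℂ) (N : ℕ) (z : ℂ)
    (b c : n) : (blockMonomials n (N + 1) z * (blockToeplitz a (N + 1) * blockFirst n (N + 1))) b c =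
      ∑ k ∈ Finset.range (N + 1), z ^ k * a k b c := by
  rw [blockMonomials_mul_apply, Finset.sum_range]
  refine Finset.sum_congr rfl fun k _ => ?_
  rw [mul_blockFirst_apply]
  simp [blockToeplitz]

theorem blockLast_mul_apply {β : Type*} (N : ℕ) (P : Matrix (Fin (N + 1) × n) β ℂ) (b : n)
    (c : β) : (blockLast n (N + 1) * P) b c = P (Fin.last N, b) c := by
  rw [mul_apply, Finset.sum_eq_single (Fin.last N, b)]
  · simp [blockLast]
  · rintro ⟨x, y⟩ _ hxy
    have : ¬((x : ℕ) + 1 = N + 1 ∧ b = y) := by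
      rintro ⟨h1, rfl⟩
      exact hxy (by rw [show x = Fin.last N from Fin.ext (by simpa using h1)])
    simp only [blockLast, of_apply, if_neg this, zero_mul]
  · simp

theorem posSemidef_one_sub_blockToeplitz {N : ℕ} {A : ℂ → Matrix n n ℂ} {a : ℕ → Matrix n n ℂ}
    (hsum : ∀ z, ‖z‖ < 1 → ∀ i j, HasSum (fun k => z ^ k * a k i j) (A z i j))
    (hA : ∀ z, ‖z‖ < 1 → (1 - A z * (A z)ᴴ).PosSemidef) :
    (1 - blockToeplitz a N * (blockToeplitz a N)ᴴ).PosSemidef := by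
  set T := blockToeplitz a N with hT
  refine PosSemidef.of_dotProduct_mulVec_nonneg
    (isHermitian_one.sub (isHermitian_mul_conjTranspose_self T)) fun x => ?_
  have hself : ∀ {l : Type} [Fintype l] (w : l → ℂ),
      star w ⬝ᵥ w = ((∑ i, ‖w i‖ ^ 2 : ℝ) : ℂ) := by
    intro l _ w
    rw [← re_star_dotProduct_self]
    refine Complex.ext (by simp) ?_
    simpa using ((Complex.le_def.1 (dotProduct_star_self_nonneg w)).2).symm
  rw [sub_mulVec, one_mulVec, dotProduct_sub, ← mulVec_mulVec, dotProduct_mulVec _ T,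
    ← conjTranspose_conjTranspose T, ← star_mulVec, conjTranspose_conjTranspose, hself, hself,
    sub_nonneg, Complex.real_le_real, Fintype.sum_prod_type, Fintype.sum_prod_type]
  convert toeplitz_bessel hsum hA fun i c => x (i, c) using 6 with j _ b
  rw [mulVec, dotProduct, Fintype.sum_prod_type]
  refine Finset.sum_congr rfl fun i _ => Finset.sum_congr rfl fun c _ => ?_
  simp [hT, blockToeplitz, conjTranspose_apply, apply_ite star]

/-- A contractive analytic function agrees to any given order at `0` with the transfer function of
a finite-dimensional unitary colligation. -/
theorem exists_isRealized_near {A : ℂ → Matrix n n ℂ} {a : ℕ → Matrix n n ℂ}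
    (hsum : ∀ z, ‖z‖ < 1 → ∀ i j, HasSum (fun k => z ^ k * a k i j) (A z i j))
    (hA : ∀ z, ‖z‖ < 1 → (1 - A z * (A z)ᴴ).PosSemidef) (N : ℕ) :
    ∃ (p : ℂ[X]) (Θ : ℂ → Matrix n n ℂ), IsRealized p Θ ∧ ∀ z, ‖z‖ < 1 → ∀ i j,
      ‖Θ z i j - ∑ k ∈ Finset.range (N + 1), z ^ k * a k i j‖ ≤
        ‖z‖ ^ (N + 1) * (1 + (1 - ‖z‖ ^ 2)⁻¹) := by
  set T := blockToeplitz a (N + 1) with hT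
  set Z := blockShift n (N + 1) with hZ
  set E := blockFirst n (N + 1) with hE
  obtain ⟨G, hG⟩ : ∃ G, 1 - T * Tᴴ = G * Gᴴ :=
    (posSemidef_one_sub_blockToeplitz hsum hA).exists_eq_mul_conjTranspose
  have hZT : Z * T = T * Z := blockShift_mul_blockToeplitz a (N + 1)
  have hZE : Z * Zᴴ + E * Eᴴ = 1 := blockShift_mul_conjTranspose_add N
  -- Displacement identity: since `Z` commutes with `T`, the difference `G Gᴴ - Z G Gᴴ Zᴴ` equals `E
  -- Eᴴ - T E Eᴴ Tᴴ`. Moving the negative terms across gives two equal Gram matrices, and the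
  -- unitary relating them is the colligation.
  have hgram : fromCols G (T * E) * (fromCols G (T * E))ᴴ =
      fromCols (Z * G) E * (fromCols (Z * G) E)ᴴ := by
    simp only [conjTranspose_fromCols_eq_fromRows_conjTranspose, fromCols_mul_fromRows]
    have e1 : Z * G * (Z * G)ᴴ = Z * Zᴴ - T * (Z * Zᴴ) * Tᴴ := by
      calc Z * G * (Z * G)ᴴ = Z * (G * Gᴴ) * Zᴴ := by
            simp only [conjTranspose_mul, Matrix.mul_assoc]
        _ = Z * Zᴴ - (Z * T) * (Z * T)ᴴ := by
            rw [← hG, Matrix.mul_sub, Matrix.mul_one, Matrix.sub_mul, conjTranspose_mul]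
            simp only [Matrix.mul_assoc]
        _ = _ := by
            rw [hZT, conjTranspose_mul]
            simp only [Matrix.mul_assoc]
    have e2 : T * E * (T * E)ᴴ = T * (E * Eᴴ) * Tᴴ := by
      simp only [conjTranspose_mul, Matrix.mul_assoc]
    have e3 : E * Eᴴ = 1 - Z * Zᴴ := by rw [← hZE]; abel
    rw [e1, e2, e3, ← hG, Matrix.mul_sub, Matrix.sub_mul, Matrix.mul_one]
    abel
  obtain ⟨U, hU, hGU⟩ := exists_unitary_of_mul_conjTranspose_eq hgram
  obtain ⟨M, B, C, D, rfl⟩ : ∃ M B C D, U = fromBlocks M B C D :=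
    ⟨_, _, _, _, (fromBlocks_toBlocks U).symm⟩
  rw [fromCols_mul_fromBlocks, fromCols_ext_iff] at hGU
  obtain ⟨hG1, hG2⟩ := hGU
  have hM := (fromBlocks_conjTranspose_mul_self_eq_one_iff.1 hU).1
  have ht := fun z (hz : ‖z‖ < 1) => (isTransferValue_iff (B := B) (C := C)
    (D := D) (det_one_sub_smul_ne_zero hM hz)).2 rfl
  refine ⟨M.charpoly, _, ⟨_, _, _, M, B, C, D, hU, rfl, ht⟩, fun z hz => ?_⟩
  obtain ⟨X, hX, hΘ⟩ := ht z hz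
  have hXX := one_sub_transfer_eq hU hX hΘ
  rw [hΘ] at hXX ⊢
  intro i j
  rw [← blockMonomials_mul_blockToeplitz_mul_blockFirst, ← hT, ← hE]
  set e := blockMonomials n (N + 1) z with he
  set Λ := blockLast n (N + 1) with hΛ
  have heZ : e * Z = z • e - z ^ (N + 1) • Λ := blockMonomials_mul_blockShift _ z
  have heE : e * E = 1 := blockMonomials_mul_blockFirst N z
  have heG : e * G = z • (e * (G * M)) - z ^ (N + 1) • (Λ * (G * M)) + C := by
    calc e * G = e * Z * (G * M) + e * E * C := by
          conv_lhs => rw [hG1]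
          simp only [Matrix.mul_add, Matrix.mul_assoc]
      _ = _ := by
          rw [heZ, heE, Matrix.one_mul, Matrix.sub_mul, Matrix.smul_mul, Matrix.smul_mul]
  have heT : e * (T * E) = z • (e * (G * B)) - z ^ (N + 1) • (Λ * (G * B)) + D := by
    calc e * (T * E) = e * Z * (G * B) + e * E * D := by
          rw [hG2]
          simp only [Matrix.mul_add, Matrix.mul_assoc]
      _ = _ := by
          rw [heZ, heE, Matrix.one_mul, Matrix.sub_mul, Matrix.smul_mul, Matrix.smul_mul]
  -- Multiplying the colligation equations on the left by `e` and eliminating `e * G` leaves only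
  -- the boundary term of the shift.
  have hdiff : z • (C * X) + D - e * (T * E) = z ^ (N + 1) • (Λ * (G * X)) := by
    have h1 : C * X = e * (G * X) - z • (e * (G * (M * X))) +
        z ^ (N + 1) • (Λ * (G * (M * X))) := by
      have := congrArg (· * X) heG
      simp only [Matrix.add_mul, Matrix.sub_mul, Matrix.smul_mul, Matrix.mul_assoc] at this
      rw [this]
      abel
    have h2 : ∀ P : Matrix n (Fin (N + 1) × n) ℂ,
        P * (G * X) = z • (P * (G * (M * X))) + P * (G * B) := by
      intro P
      calc P * (G * X) = P * (G * (z • (M * X) + B)) := by rw [← hX]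
        _ = _ := by simp only [Matrix.mul_add, Matrix.mul_smul]
    rw [h1, heT, h2 e, h2 Λ]
    simp only [smul_add, smul_sub, smul_smul]
    rw [mul_comm z (z ^ (N + 1))]
    abel
  have hentry := congrFun (congrFun hdiff i) j
  rw [Matrix.sub_apply, Matrix.smul_apply, blockLast_mul_apply, smul_eq_mul] at hentry
  rw [hentry, norm_mul, norm_pow]
  refine mul_le_mul_of_nonneg_left ?_ (by positivity)
  have hz2 : 0 < 1 - ‖z‖ ^ 2 := by nlinarith [norm_nonneg z]
  -- Diagonal entries of `1 - Θᴴ Θ = (1 - ‖z‖²) Xᴴ X`.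
  have hcol : ∑ k, ‖X k j‖ ^ 2 ≤ (1 - ‖z‖ ^ 2)⁻¹ := by
    have h1 := congrArg Complex.re (congrFun (congrFun hXX j) j)
    have h2 : ((Xᴴ * X) j j).re = ∑ k, ‖X k j‖ ^ 2 := by
      rw [← re_star_dotProduct_self (fun k => X k j)]
      rfl
    have h3 : ∀ Φ : Matrix n n ℂ, 0 ≤ ((Φᴴ * Φ) j j).re := by
      intro Φ
      have : ((Φᴴ * Φ) j j).re = ∑ k, ‖Φ k j‖ ^ 2 := by
        rw [← re_star_dotProduct_self (fun k => Φ k j)]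
        rfl
      rw [this]
      positivity
    rw [Matrix.sub_apply, Matrix.smul_apply, one_apply_eq, Complex.sub_re, Complex.one_re,
      Complex.smul_re, h2, smul_eq_mul] at h1
    have h4 := h3 (z • (C * X) + D)
    rw [← one_div, le_div_iff₀ hz2]
    linarith
  have hrow : ∑ k, ‖G (Fin.last N, i) k‖ ^ 2 ≤ 1 := by
    have h1 := congrArg Complex.re (congrFun (congrFun hG (Fin.last N, i)) (Fin.last N, i))
    have h2 : ∀ P : Matrix (Fin (N + 1) × n) (Fin (N + 1) × n) ℂ,
        ((P * Pᴴ) (Fin.last N, i) (Fin.last N, i)).re = ∑ k, ‖P (Fin.last N, i) k‖ ^ 2 := by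
      intro P
      rw [← re_star_dotProduct_self, dotProduct_comm]
      rfl
    rw [Matrix.sub_apply, one_apply_eq, Complex.sub_re, Complex.one_re, h2, h2] at h1
    have h3 : 0 ≤ ∑ k, ‖T (Fin.last N, i) k‖ ^ 2 := by positivity
    linarith
  rw [mul_apply]
  -- The crude bound `a b ≤ a² + b²` suffices, and gives a constant independent of `N`.
  calc ‖∑ k, G (Fin.last N, i) k * X k j‖ ≤ ∑ k, ‖G (Fin.last N, i) k * X k j‖ := norm_sum_le _ _
    _ ≤ ∑ k, (‖G (Fin.last N, i) k‖ ^ 2 + ‖X k j‖ ^ 2) := by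
        refine Finset.sum_le_sum fun k _ => ?_
        rw [norm_mul]
        nlinarith [sq_nonneg (‖G (Fin.last N, i) k‖ - ‖X k j‖),
          sq_nonneg (‖G (Fin.last N, i) k‖), sq_nonneg ‖X k j‖]
    _ ≤ _ := by
        rw [Finset.sum_add_distrib]
        exact add_le_add hrow hcol

end Toeplitz

/-- A pointwise limit of holomorphic functions on the unit disk bounded by `1` is holomorphic. -/
theorem differentiableOn_ball_of_tendsto {ι : Type*} {l : Filter ι} [l.NeBot] {f : ι → ℂ → ℂ}
    {g : ℂ → ℂ} (hf : ∀ i, DifferentiableOn ℂ (f i) (Metric.ball 0 1))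
    (hb : ∀ i, ∀ z ∈ Metric.ball (0 : ℂ) 1, ‖f i z‖ ≤ 1)
    (hg : ∀ z ∈ Metric.ball (0 : ℂ) 1, Tendsto (fun i => f i z) l (𝓝 (g z))) :
    DifferentiableOn ℂ g (Metric.ball 0 1) := by
  refine TendstoLocallyUniformlyOn.differentiableOn (F := f) (φ := l) ?_
    (Eventually.of_forall hf) Metric.isOpen_ball
  rw [Metric.tendstoLocallyUniformlyOn_iff]
  intro ε hε z₀ hz₀
  have hR : 0 < 1 - ‖z₀‖ := by simpa using hz₀
  set R := 1 - ‖z₀‖ with hRdef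
  have hsub : Metric.ball z₀ R ⊆ Metric.ball 0 1 := by
    apply Metric.ball_subset_ball'
    rw [dist_zero_right, hRdef]
    linarith
  -- The Schwarz lemma gives a Lipschitz bound at `z₀` uniform in `i`: values bounded by `1` lie
  -- within distance `2` of `f i z₀`. This equicontinuity upgrades pointwise to locally uniform
  -- convergence.
  have hlip : ∀ i, ∀ z ∈ Metric.ball z₀ R, dist (f i z) (f i z₀) ≤ 2 / R * dist z z₀ := by
    intro i z hz
    refine Complex.dist_le_div_mul_dist_of_mapsTo_ball ((hf i).mono hsub) (fun w hw => ?_) hz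
    rw [Metric.mem_closedBall, dist_eq_norm]
    refine (norm_sub_le _ _).trans ?_
    linarith [hb i w (hsub hw), hb i z₀ hz₀]
  have hlipg : ∀ z ∈ Metric.ball z₀ R, dist (g z) (g z₀) ≤ 2 / R * dist z z₀ := fun z hz =>
    le_of_tendsto ((hg z (hsub hz)).dist (hg z₀ hz₀)) (Eventually.of_forall fun i => hlip i z hz)
  have hδ : 0 < min R (ε / 3 * (R / 2)) := by positivity
  refine ⟨Metric.ball z₀ (min R (ε / 3 * (R / 2))),
    mem_nhdsWithin_of_mem_nhds (Metric.ball_mem_nhds _ hδ), ?_⟩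
  filter_upwards [(hg z₀ hz₀).eventually (Metric.ball_mem_nhds _ (by positivity : 0 < ε / 3))]
    with i hi z hz
  have hzR : z ∈ Metric.ball z₀ R := Metric.ball_subset_ball (min_le_left _ _) hz
  have hsmall : 2 / R * dist z z₀ < ε / 3 := by
    have : dist z z₀ < ε / 3 * (R / 2) := lt_of_lt_of_le hz (min_le_right _ _)
    calc 2 / R * dist z z₀ < 2 / R * (ε / 3 * (R / 2)) := by gcongr
      _ = ε / 3 := by field_simp
  have h1 := hlip i z hzR
  have h2 := hlipg z hzR
  have h3 : dist (f i z₀) (g z₀) < ε / 3 := hi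
  calc dist (g z) (f i z) ≤ dist (g z) (g z₀) + dist (g z₀) (f i z₀) + dist (f i z₀) (f i z) :=
        dist_triangle4 _ _ _ _
    _ < ε := by
        rw [dist_comm (g z₀), dist_comm (f i z₀) (f i z)]
        linarith

/-! ### Compactness and passage to the limit -/

section Limit

variable {n : Type} [Fintype n] [DecidableEq n]

theorem norm_apply_le_one_of_posSemidef {A : Matrix n n ℂ} (hA : (1 - A * Aᴴ).PosSemidef)
    (i j : n) : ‖A i j‖ ≤ 1 := by
  have h := sum_norm_sq_conjTranspose_mulVec_le hA (Pi.single i 1)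
  have h1 : ∑ a, ‖(Pi.single i 1 : n → ℂ) a‖ ^ 2 = 1 := by
    rw [Finset.sum_eq_single i] <;> simp +contextual
  have h2 : ‖A i j‖ ^ 2 ≤ ∑ b, ‖(Aᴴ *ᵥ Pi.single i 1) b‖ ^ 2 := by
    refine le_trans (le_of_eq ?_) (Finset.single_le_sum (fun b _ => by positivity)
      (Finset.mem_univ j))
    simp
  rw [h1] at h
  nlinarith [norm_nonneg (A i j)]

theorem posSemidef_one_sub_of_tendsto {ι : Type*} {l : Filter ι} [l.NeBot] {F : ι → Matrix n n ℂ}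
    {A : Matrix n n ℂ} (hF : Tendsto F l (𝓝 A)) (h : ∀ i, (1 - F i * (F i)ᴴ).PosSemidef) :
    (1 - A * Aᴴ).PosSemidef := by
  refine PosSemidef.of_dotProduct_mulVec_nonneg
    (isHermitian_one.sub (isHermitian_mul_conjTranspose_self A)) fun x => ?_
  have hc : Continuous fun M : Matrix n n ℂ => star x ⬝ᵥ (1 - M * Mᴴ) *ᵥ x := by fun_prop
  exact ge_of_tendsto' ((hc.tendsto A).comp hF) fun i => (h i).dotProduct_mulVec_nonneg x

/-- Compactness of the class of contractive analytic functions along an ultrafilter. -/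
theorem exists_contractive_limit (l : Ultrafilter ℕ) {F : ℕ → ℂ → Matrix n n ℂ}
    (hF : ∀ N i j, DifferentiableOn ℂ (fun z => F N z i j) (Metric.ball 0 1))
    (hc : ∀ N z, ‖z‖ < 1 → (1 - F N z * (F N z)ᴴ).PosSemidef) :
    ∃ B : ℂ → Matrix n n ℂ, (∀ i j, DifferentiableOn ℂ (fun z => B z i j) (Metric.ball 0 1)) ∧
      (∀ z, ‖z‖ < 1 → (1 - B z * (B z)ᴴ).PosSemidef) ∧
      ∀ z, ‖z‖ < 1 → Tendsto (fun N => F N z) l (𝓝 (B z)) := by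
  -- Entries are bounded by `1`, so the ultrafilter gives pointwise limits at every point of the
  -- disk without extracting subsequences; outside the disk the value is arbitrary.
  have hlim : ∀ z i j, ∃ w : ℂ, ‖z‖ < 1 → Tendsto (fun N => F N z i j) l (𝓝 w) := by
    intro z i j
    by_cases hz : ‖z‖ < 1
    · obtain ⟨w, -, hw⟩ := (isCompact_closedBall (0 : ℂ) 1).ultrafilter_le_nhds'
        (l.map fun N => F N z i j) (by
          refine Filter.Eventually.of_forall (f := (l : Filter ℕ)) fun N => ?_
          simpa using norm_apply_le_one_of_posSemidef (hc N z hz) i j)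
      exact ⟨w, fun _ => hw⟩
    · exact ⟨0, fun h => absurd h hz⟩
  choose B hB using hlim
  have hT : ∀ z, ‖z‖ < 1 → Tendsto (fun N => F N z) l (𝓝 (of (B z))) := by
    intro z hz
    exact tendsto_pi_nhds.2 fun i => tendsto_pi_nhds.2 fun j => hB z i j hz
  refine ⟨fun z => of (B z), fun i j => ?_, fun z hz => ?_, hT⟩
  · refine differentiableOn_ball_of_tendsto (l := (l : Filter ℕ)) (fun N => hF N i j)
      (fun N z hz => ?_) (fun z hz => hB z i j (by simpa using hz))
    exact norm_apply_le_one_of_posSemidef (hc N z (by simpa using hz)) i j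
  · exact posSemidef_one_sub_of_tendsto (hT z hz) fun N => hc N z hz

/-- The realized approximants differ from the Taylor sums by `O(‖z‖ ^ (N + 1))` at each fixed `z`,
and the Taylor sums converge. -/
theorem exists_isRealized_tendsto {A : ℂ → Matrix n n ℂ}
    (hA : ∀ i j, DifferentiableOn ℂ (fun z => A z i j) (Metric.ball 0 1))
    (hc : ∀ z, ‖z‖ < 1 → (1 - A z * (A z)ᴴ).PosSemidef) :
    ∃ (p : ℕ → ℂ[X]) (Θ : ℕ → ℂ → Matrix n n ℂ), (∀ N, IsRealized (p N) (Θ N)) ∧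
      ∀ z, ‖z‖ < 1 → Tendsto (fun N => Θ N z) atTop (𝓝 (A z)) := by
  let a : ℕ → Matrix n n ℂ := fun k => of fun i j =>
    ((k.factorial : ℂ)⁻¹ * iteratedDeriv k (fun z => A z i j) 0)
  have hsum : ∀ z, ‖z‖ < 1 → ∀ i j, HasSum (fun k => z ^ k * a k i j) (A z i j) := by
    intro z hz i j
    have h := Complex.hasSum_taylorSeries_on_ball (hA i j) (z := z) (by simpa using hz)
    have e : ∀ k, z ^ k * a k i j =
        (k.factorial : ℂ)⁻¹ • (z - 0) ^ k • iteratedDeriv k (fun z => A z i j) 0 := by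
      intro k
      simp only [a, of_apply, smul_eq_mul, sub_zero]
      ring
    simpa only [e] using h
  choose p Θ hΘ hnear using exists_isRealized_near hsum hc
  refine ⟨p, Θ, hΘ, fun z hz => ?_⟩
  refine tendsto_pi_nhds.2 fun i => tendsto_pi_nhds.2 fun j => ?_
  have h1 : Tendsto (fun N => Θ N z i j - ∑ k ∈ Finset.range (N + 1), z ^ k * a k i j) atTop
      (𝓝 0) := by
    refine squeeze_zero_norm (fun N => hnear N z hz i j) ?_
    have := ((tendsto_pow_atTop_nhds_zero_of_lt_one (norm_nonneg z) hz).comp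
      (tendsto_add_atTop_nat 1)).mul_const (1 + (1 - ‖z‖ ^ 2)⁻¹)
    simpa using this
  have h2 := (hsum z hz i j).tendsto_sum_nat.comp (tendsto_add_atTop_nat 1)
  simpa [Function.comp_def] using h1.add h2

/-- Swapping the factors, with determinants preserved up to unimodular constants. -/
theorem exists_swap_up_to_constants {A₁ A₂ : ℂ → Matrix n n ℂ}
    (hA₁ : ∀ i j, DifferentiableOn ℂ (fun z => A₁ z i j) (Metric.ball 0 1))
    (hc₁ : ∀ z, ‖z‖ < 1 → (1 - A₁ z * (A₁ z)ᴴ).PosSemidef)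
    (hA₂ : ∀ i j, DifferentiableOn ℂ (fun z => A₂ z i j) (Metric.ball 0 1))
    (hc₂ : ∀ z, ‖z‖ < 1 → (1 - A₂ z * (A₂ z)ᴴ).PosSemidef) :
    ∃ (B₁ B₂ : ℂ → Matrix n n ℂ) (c d : ℂ),
      (∀ i j, DifferentiableOn ℂ (fun z => B₁ z i j) (Metric.ball 0 1)) ∧
      (∀ z, ‖z‖ < 1 → (1 - B₁ z * (B₁ z)ᴴ).PosSemidef) ∧
      (∀ i j, DifferentiableOn ℂ (fun z => B₂ z i j) (Metric.ball 0 1)) ∧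
      (∀ z, ‖z‖ < 1 → (1 - B₂ z * (B₂ z)ᴴ).PosSemidef) ∧
      ‖c‖ = 1 ∧
      (∀ z, ‖z‖ < 1 → A₁ z * A₂ z = B₂ z * B₁ z) ∧
      (∀ z, ‖z‖ < 1 → (B₁ z).det = c * (A₁ z).det) ∧
      (∀ z, ‖z‖ < 1 → (B₂ z).det = d * (A₂ z).det) := by
  obtain ⟨p, Θ₁, hΘ₁, hT₁⟩ := exists_isRealized_tendsto hA₁ hc₁
  obtain ⟨q, Θ₂, hΘ₂, hT₂⟩ := exists_isRealized_tendsto hA₂ hc₂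
  choose Φ₁ Φ₂ hΦ₁ hΦ₂ hswap using fun N => (hΘ₁ N).exists_swap (hΘ₂ N)
  choose c hc hdet₁ using fun N => (hΦ₁ N).exists_det_eq (hΘ₁ N)
  choose d hd hdet₂ using fun N => (hΦ₂ N).exists_det_eq (hΘ₂ N)
  -- One ultrafilter finer than `atTop` serves both factors and both sequences of constants, while
  -- keeping the known limits `A₁` and `A₂`.
  let l : Ultrafilter ℕ := hyperfilter ℕ
  have hl : (l : Filter ℕ) ≤ atTop := Nat.hyperfilter_le_atTop
  obtain ⟨B₁, hB₁, hB₁', hL₁⟩ := exists_contractive_limit l (fun N => (hΦ₁ N).differentiableOn)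
    fun N z hz => (hΦ₁ N).posSemidef hz
  obtain ⟨B₂, hB₂, hB₂', hL₂⟩ := exists_contractive_limit l (fun N => (hΦ₂ N).differentiableOn)
    fun N z hz => (hΦ₂ N).posSemidef hz
  have hconst : ∀ e : ℕ → ℂ, (∀ N, ‖e N‖ = 1) → ∃ w : ℂ, ‖w‖ = 1 ∧ Tendsto e l (𝓝 w) := by
    intro e he
    obtain ⟨w, hw, hew⟩ := (isCompact_sphere (0 : ℂ) 1).ultrafilter_le_nhds' (l.map e)
      (Filter.Eventually.of_forall (f := (l : Filter ℕ)) fun N => by simpa using he N)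
    exact ⟨w, by simpa using hw, hew⟩
  obtain ⟨c', hc', hcT⟩ := hconst c hc
  obtain ⟨d', -, hdT⟩ := hconst d hd
  have hdetlim : ∀ {F : ℕ → Matrix n n ℂ} {M : Matrix n n ℂ}, Tendsto F l (𝓝 M) →
      Tendsto (fun N => (F N).det) l (𝓝 M.det) := fun {F M} h =>
    ((continuous_id.matrix_det).tendsto M).comp h
  refine ⟨B₁, B₂, c', d', hB₁, hB₁', hB₂, hB₂', hc', fun z hz => ?_, fun z hz => ?_,
    fun z hz => ?_⟩
  · refine tendsto_nhds_unique (((hT₁ z hz).mono_left hl).mul ((hT₂ z hz).mono_left hl)) ?_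
    simp only [fun N => hswap N z hz]
    exact (hL₂ z hz).mul (hL₁ z hz)
  · refine tendsto_nhds_unique (hdetlim (hL₁ z hz)) ?_
    simp only [fun N => hdet₁ N z hz]
    exact hcT.mul (hdetlim ((hT₁ z hz).mono_left hl))
  · refine tendsto_nhds_unique (hdetlim (hL₂ z hz)) ?_
    simp only [fun N => hdet₂ N z hz]
    exact hdT.mul (hdetlim ((hT₂ z hz).mono_left hl))

end Limit

/-! ### Removing the unimodular constants -/

theorem smul_mul_conjTranspose_of_norm_eq_one {n : Type*} [Fintype n] {c : ℂ} (hc : ‖c‖ = 1) (A : Matrix n n ℂ) :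
    (c • A) * (c • A)ᴴ = A * Aᴴ := by
  rw [conjTranspose_smul, Matrix.smul_mul, Matrix.mul_smul, smul_smul, Complex.star_def,
    Complex.mul_conj', hc]
  simp

theorem mainTheorem9 {n : ℕ} (A₁ A₂ : ℂ → Matrix (Fin n) (Fin n) ℂ)
    (hA₁ : IsSchurClass A₁) (hA₂ : IsSchurClass A₂) :
    ∃ B₁ B₂ : ℂ → Matrix (Fin n) (Fin n) ℂ,
      IsSchurClass B₁ ∧ IsSchurClass B₂ ∧
      (∀ z ∈ Metric.ball (0 : ℂ) 1, A₁ z * A₂ z = B₂ z * B₁ z) ∧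
      (∀ z ∈ Metric.ball (0 : ℂ) 1, (A₁ z).det = (B₁ z).det) ∧
      (∀ z ∈ Metric.ball (0 : ℂ) 1, (A₂ z).det = (B₂ z).det) := by
  -- Size zero is separate because the n-th root of `c` below needs `0 < n`.
  rcases Nat.eq_zero_or_pos n with rfl | hn
  · exact ⟨A₁, A₂, hA₁, hA₂, fun z _ => Subsingleton.elim _ _, fun _ _ => rfl, fun _ _ => rfl⟩
  obtain ⟨B₁, B₂, c, d, hB₁, hB₁', hB₂, hB₂', hc, hmul, hdet₁, hdet₂⟩ :=
    exists_swap_up_to_constants hA₁.analytic (fun z hz => hA₁.contractive z (by simpa using hz))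
      hA₂.analytic (fun z hz => hA₂.contractive z (by simpa using hz))
  -- By the identity theorem the two determinants have a common point of nonvanishing; comparing
  -- determinants of the two products there gives the relation.
  have hcd : c * d = 1 := by
    obtain ⟨z, hz, hz0⟩ : ∃ z : ℂ, ‖z‖ < 1 ∧ (A₁ z).det * (A₂ z).det ≠ 0 := by
      by_contra! hcon
      have han : ∀ {A : ℂ → Matrix (Fin n) (Fin n) ℂ}, IsSchurClass A →
          AnalyticOnNhd ℂ (fun z => (A z).det) (Metric.ball 0 1) := fun h =>
        (DifferentiableOn.matrix_det h.analytic).analyticOnNhd Metric.isOpen_ball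
      obtain ⟨z₁, hz₁, h₁⟩ := hA₁.det_ne_zero
      obtain ⟨z₂, hz₂, h₂⟩ := hA₂.det_ne_zero
      rcases AnalyticOnNhd.eq_zero_or_eq_zero_of_mul_eq_zero (han hA₁) (han hA₂)
        (fun z hz => hcon z (by simpa using hz))
        (convex_ball (0 : ℂ) 1).isPreconnected with h | h
      · exact h₁ (h z₁ hz₁)
      · exact h₂ (h z₂ hz₂)
    have h1 := congrArg det (hmul z hz)
    rw [det_mul, det_mul, hdet₁ z hz, hdet₂ z hz] at h1
    have h2 : (c * d - 1) * ((A₁ z).det * (A₂ z).det) = 0 := by linear_combination -h1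
    exact sub_eq_zero.1 ((mul_eq_zero.1 h2).resolve_right hz0)
  -- Scaling by `ζ⁻¹` and `ζ` leaves the product unchanged and multiplies the determinants by `c⁻¹`
  -- and `c = d⁻¹`.
  obtain ⟨ζ, hζ⟩ := IsAlgClosed.exists_pow_nat_eq c hn
  have hζ1 : ‖ζ‖ = 1 := by
    have : ‖ζ‖ ^ n = 1 := by rw [← norm_pow, hζ, hc]
    exact (pow_eq_one_iff_of_nonneg (norm_nonneg _) hn.ne').1 this
  have hζ0 : ζ ≠ 0 := by
    rintro rfl
    simp at hζ1
  have hc0 : c ≠ 0 := left_ne_zero_of_mul_eq_one hcd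
  have e₁ : ∀ z ∈ Metric.ball (0 : ℂ) 1, (A₁ z).det = (ζ⁻¹ • B₁ z).det := by
    intro z hz
    rw [det_smul, Fintype.card_fin, hdet₁ z (by simpa using hz), inv_pow, hζ,
      inv_mul_cancel_left₀ hc0]
  have e₂ : ∀ z ∈ Metric.ball (0 : ℂ) 1, (A₂ z).det = (ζ • B₂ z).det := by
    intro z hz
    rw [det_smul, Fintype.card_fin, hdet₂ z (by simpa using hz), hζ, ← mul_assoc, hcd, one_mul]
  refine ⟨fun z => ζ⁻¹ • B₁ z, fun z => ζ • B₂ z, ⟨fun i j => ?_, fun z hz => ?_, ?_⟩,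
    ⟨fun i j => ?_, fun z hz => ?_, ?_⟩, fun z hz => ?_, e₁, e₂⟩
  · exact (hB₁ i j).const_mul ζ⁻¹
  · rw [smul_mul_conjTranspose_of_norm_eq_one (by rw [norm_inv, hζ1, inv_one])]
    exact hB₁' z (by simpa using hz)
  · obtain ⟨z, hz, h⟩ := hA₁.det_ne_zero
    exact ⟨z, hz, by rwa [← e₁ z hz]⟩
  · exact (hB₂ i j).const_mul ζ
  · rw [smul_mul_conjTranspose_of_norm_eq_one hζ1]
    exact hB₂' z (by simpa using hz)
  · obtain ⟨z, hz, h⟩ := hA₂.det_ne_zero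
    exact ⟨z, hz, by rwa [← e₂ z hz]⟩
  · rw [hmul z (by simpa using hz), Matrix.smul_mul, Matrix.mul_smul, smul_smul,
      mul_inv_cancel₀ hζ0, one_smul]
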